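/- Let $G$ be a complex Lie group with Lie algebra $\mathfrak g$, let $G_0$ be a real Lie group with Lie algebra $\mathfrak g_0$ (Lie groups are finite dimensional and second countable), and let $j\colon G_0\to G$ be a smooth homomorphism that makes $G_0$ a real form of $G$: the complex-linear extension $\mathfrak g_0\otimes_{\mathbb R}\mathbb C\to\mathfrak g$ of the differential of $j$ at $1$ is bijective, so that $\mathfrak g=\mathfrak g_0^{\mathbb C}$. (For instance, $G_0$ and $G$ are connected and simply connected, $\mathfrak g=\mathfrak g_0^{\mathbb C}$, and $j$ integrates the inclusion $\mathfrak g_0\subset\mathfrak g$.) The group $G$ acts on the complex dual space $\mathfrak g^*$ by the coadjoint action, and $G_0$ acts on $\mathfrak g^*$ through $j$. Let $z_0\in\mathfrak g^*$, let $M=G(z_0)$ be its $G$-orbit, and let ${\mathcal O}=G_0(z_0)\subset M$ be its $G_0$-orbit. Each orbit carries its manifold structure as an orbit, namely the unique one for which the orbit map from the acting group is a submersion; submanifolds are understood to be injectively immersed. For a real submanifold $L$ of a complex manifold $M$ with complex structure $\mathcal J$, put $T_x^{1,0}L=(T_xL\otimes\mathbb C)\cap T_x^{1,0}M$; $L$ is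 a CR-submanifold if $\dim_{\mathbb C}T^{1,0}_xL$ does not depend on $x\in L$, and it is generic if moreover $T_xL+\mathcal J\,T_xL=T_xM$ for all $x\in L$. For $z\in\mathfrak g^*$ let $\mathfrak g^z$ and $\mathfrak g_0^z$ be the Lie algebras of the stabilizers of $z$ in $G$ and in $G_0$. Then $M$ is a complex submanifold of $\mathfrak g^*$, and ${\mathcal O}$ is a generic CR-submanifold of $M$. Moreover, for every $z\in{\mathcal O}$ one has $(\mathfrak g_0^z)^{\mathbb C}\subset\mathfrak g^z$, and there is an isomorphism of complex vector spaces $$T_z^{1,0}{\mathcal O}\;\cong\;\mathfrak g^z/(\mathfrak g_0^z)^{\mathbb C}.$$ -/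

import Mathlib

open scoped Manifold ContDiff Topology TensorProduct

namespace CoadjointCR

/-! ### Submanifolds and CR geometry -/

section Submanifold

variable {𝕜 : Type*} [NontriviallyNormedField 𝕜]
  {E : Type*} [NormedAddCommGroup E] [NormedSpace 𝕜 E]
  {F : Type*} [NormedAddCommGroup F] [NormedSpace 𝕜 F]
  {L : Type*} [TopologicalSpace L] [ChartedSpace E L]
  {M : Type*} [TopologicalSpace M] [ChartedSpace F M]

variable (𝕜 E F) in
/-- `ι` exhibits `L` as an (immersed) submanifold of the finite-dimensional manifold `M`:
it is a smooth injective immersion. For `𝕜 = ℂ`, "smooth" means holomorphic. -/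
structure IsSubmanifold (ι : L → M) : Prop where
  contMDiff : ContMDiff 𝓘(𝕜, E) 𝓘(𝕜, F) ∞ ι
  injective : Function.Injective ι
  injective_mfderiv : ∀ x, Function.Injective (mfderiv 𝓘(𝕜, E) 𝓘(𝕜, F) ι x)

end Submanifold

section CR

variable {E₀ : Type*} [NormedAddCommGroup E₀] [NormedSpace ℝ E₀]
  {F : Type*} [NormedAddCommGroup F] [NormedSpace ℂ F]
  {L : Type*} [TopologicalSpace L] [ChartedSpace E₀ L]
  {M : Type*} [TopologicalSpace M] [ChartedSpace F M]

variable (F) in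
/-- The complex structure of the tangent space at `y` of a complex manifold modelled on `F`. -/
noncomputable def complexStructure (y : M) :
    TangentSpace 𝓘(ℝ, F) y →ₗ[ℝ] TangentSpace 𝓘(ℝ, F) y :=
  ((LinearMap.lsmul ℂ F Complex.I).restrictScalars ℝ : F →ₗ[ℝ] F)

variable (E₀ F) in
/-- The tangent space `T_x L`, as a real subspace of `T_{ι x} M`. -/
noncomputable def tangent (ι : L → M) (x : L) : Submodule ℝ (TangentSpace 𝓘(ℝ, F) (ι x)) :=
  LinearMap.range (mfderiv 𝓘(ℝ, E₀) 𝓘(ℝ, F) ι x).toLinearMap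

variable (F) in
/-- The holomorphic tangent space `T^{1,0}_y M` inside `T_y M ⊗ ℂ`: the `i`-eigenspace of the
complexified complex structure. -/
noncomputable def holTangent (y : M) : Submodule ℂ (ℂ ⊗[ℝ] TangentSpace 𝓘(ℝ, F) y) :=
  Module.End.eigenspace ((complexStructure F y).baseChange ℂ) Complex.I

variable (E₀ F) in
/-- The `(1,0)`-tangent space `T^{1,0}_x L = (T_x L ⊗ ℂ) ∩ T^{1,0}_x M`. -/
noncomputable def tangentOneZero (ι : L → M) (x : L) :
    Submodule ℂ (ℂ ⊗[ℝ] TangentSpace 𝓘(ℝ, F) (ι x)) :=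
  (tangent E₀ F ι x).baseChange ℂ ⊓ holTangent F (ι x)

variable (E₀ F) in
/-- A CR-submanifold of a complex manifold: a real submanifold whose `(1,0)`-tangent spaces have
constant dimension. -/
structure IsCRSubmanifold (ι : L → M) : Prop where
  isSubmanifold : IsSubmanifold ℝ E₀ F ι
  constant_dim : ∃ d : ℕ, ∀ x, Module.finrank ℂ (tangentOneZero E₀ F ι x) = d

variable (E₀ F) in
/-- A CR-submanifold is generic if `T_x L + J T_x L = T_x M` at each of its points. -/
structure IsGenericCRSubmanifold (ι : L → M) : Prop extends IsCRSubmanifold E₀ F ι where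
  generic : ∀ x, tangent E₀ F ι x ⊔ (tangent E₀ F ι x).map (complexStructure F (ι x)) = ⊤

end CR

/-! ### Lie groups, coadjoint action, orbits, stabilizers

For a Lie group `G` modelled on `E`, the Lie algebra `𝔤 = T_1 G` is, by Mathlib's definition of
the tangent space, the vector space `E`, and `𝔤* = StrongDual 𝕜 E`. -/

section Group

variable {𝕜 : Type*} [NontriviallyNormedField 𝕜]
  {E : Type*} [NormedAddCommGroup E] [NormedSpace 𝕜 E]
  {F : Type*} [NormedAddCommGroup F] [NormedSpace 𝕜 F]
  {G : Type*} [TopologicalSpace G] [ChartedSpace E G] [Group G]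
  {X : Type*} [TopologicalSpace X] [ChartedSpace F X]

variable (𝕜 E) in
/-- The adjoint representation of `G` on `𝔤 = T_1 G`: the differential at `1` of conjugation. -/
noncomputable def Ad (g : G) : E →L[𝕜] E :=
  (mfderiv 𝓘(𝕜, E) 𝓘(𝕜, E) (fun x : G => g * x * g⁻¹) 1 :
    TangentSpace 𝓘(𝕜, E) (1 : G) →L[𝕜] TangentSpace 𝓘(𝕜, E) (g * 1 * g⁻¹))

/-- The coadjoint representation of `G` on `𝔤*`. -/
noncomputable def coAd (g : G) (z : StrongDual 𝕜 E) : StrongDual 𝕜 E :=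
  z.comp (Ad 𝕜 E g⁻¹)

variable (𝕜 E) in
/-- The Lie algebra of a (closed) Lie subgroup `H` of `G`, as a subspace of `𝔤 = T_1 G`: the
velocities at `1` of the germs of smooth (holomorphic if `𝕜 = ℂ`) curves in `G` that start at `1`
and stay in `H`. (For a Lie subgroup these velocities already form a subspace; the span only
makes this part of the type.) -/
noncomputable def subgroupLieAlgebra (H : Set G) : Submodule 𝕜 E :=
  Submodule.span 𝕜 {v : E | ∃ γ : 𝕜 → G, γ 0 = 1 ∧ ContMDiffAt 𝓘(𝕜, 𝕜) 𝓘(𝕜, E) ∞ γ 0 ∧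
    (∀ᶠ t in 𝓝 (0 : 𝕜), γ t ∈ H) ∧ (mfderiv 𝓘(𝕜, 𝕜) 𝓘(𝕜, E) γ 0 (1 : 𝕜) : E) = v}

variable (𝕜 E F) in
/-- The given structure on `X` is the homogeneous manifold structure determined by a surjective
orbit map `π : G → X`: `X` is a (Hausdorff, second countable) smooth manifold and `π` is a smooth
submersion. This determines the topology and the smooth structure of `X` uniquely. -/
structure IsOrbitManifold (π : G → X) : Prop where
  isManifold : IsManifold 𝓘(𝕜, F) ∞ X
  t2 : T2Space X
  secondCountable : SecondCountableTopology X
  surjective : Function.Surjective π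
  contMDiff : ContMDiff 𝓘(𝕜, E) 𝓘(𝕜, F) ∞ π
  surjective_mfderiv : ∀ g, Function.Surjective (mfderiv 𝓘(𝕜, E) 𝓘(𝕜, F) π g)

end Group

section RealForm

variable {E₀ : Type*} [NormedAddCommGroup E₀] [NormedSpace ℝ E₀]
  {E : Type*} [NormedAddCommGroup E] [NormedSpace ℂ E]
  {G₀ : Type*} [TopologicalSpace G₀] [ChartedSpace E₀ G₀] [Group G₀]
  {G : Type*} [TopologicalSpace G] [ChartedSpace E G] [Group G]

variable (E₀ E) in
/-- The differential `𝔤₀ → 𝔤` at `1` of a homomorphism `j : G₀ → G`. -/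
noncomputable def differential (j : G₀ →* G) : E₀ →L[ℝ] E :=
  (mfderiv 𝓘(ℝ, E₀) 𝓘(ℝ, E) j 1 :
    TangentSpace 𝓘(ℝ, E₀) (1 : G₀) →L[ℝ] TangentSpace 𝓘(ℝ, E) (j 1))

variable (E₀ E) in
/-- The complex-linear extension `𝔤₀ ⊗ ℂ → 𝔤` of the differential at `1` of `j : G₀ → G`. -/
noncomputable def complexifiedDifferential (j : G₀ →* G) : ℂ ⊗[ℝ] E₀ →ₗ[ℂ] E :=
  LinearMap.liftBaseChange ℂ (differential E₀ E j).toLinearMap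

variable (E₀ E) in
/-- `G₀` is a real form of the complex Lie group `G` via the smooth homomorphism `j`, which
identifies `𝔤` with the complexification of `𝔤₀`. -/
structure IsRealForm (j : G₀ →* G) : Prop where
  contMDiff : ContMDiff 𝓘(ℝ, E₀) 𝓘(ℝ, E) ∞ j
  bijective : Function.Bijective (complexifiedDifferential E₀ E j)

variable (G) in
/-- The coadjoint orbit of `G` through `z₀`. -/
def Orbit (z₀ : StrongDual ℂ E) : Type _ := {z : StrongDual ℂ E // ∃ g : G, coAd g z₀ = z}

/-- The orbit of `G₀` through `z₀ ∈ 𝔤*`. -/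
def RealOrbit (j : G₀ →* G) (z₀ : StrongDual ℂ E) : Type _ :=
  {z : StrongDual ℂ E // ∃ g : G₀, coAd (j g) z₀ = z}

/-- The orbit map `G → G(z₀)`. -/
noncomputable def orbitMap (z₀ : StrongDual ℂ E) (g : G) : Orbit G z₀ := ⟨coAd g z₀, g, rfl⟩

/-- The orbit map `G₀ → G₀(z₀)`. -/
noncomputable def realOrbitMap (j : G₀ →* G) (z₀ : StrongDual ℂ E) (g : G₀) : RealOrbit j z₀ :=
  ⟨coAd (j g) z₀, g, rfl⟩

/-- The inclusion of the `G`-orbit into `𝔤*`. -/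
def orbitInclusion (z₀ : StrongDual ℂ E) (z : Orbit G z₀) : StrongDual ℂ E := z.1

/-- The inclusion of the `G₀`-orbit into the corresponding `G`-orbit. -/
def realOrbitInclusion (j : G₀ →* G) (z₀ : StrongDual ℂ E) (z : RealOrbit j z₀) : Orbit G z₀ :=
  ⟨z.1, z.2.elim fun g hg => ⟨j g, hg⟩⟩

variable (G) in
/-- The Lie algebra `𝔤^z` of the stabilizer of `z` in `G`. -/
noncomputable def stabilizerAlgebra (z : StrongDual ℂ E) : Submodule ℂ E :=
  subgroupLieAlgebra ℂ E {g : G | coAd g z = z}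

variable (E₀) in
/-- The Lie algebra `𝔤₀^z` of the stabilizer of `z` in `G₀`. -/
noncomputable def realStabilizerAlgebra (j : G₀ →* G) (z : StrongDual ℂ E) : Submodule ℝ E₀ :=
  subgroupLieAlgebra ℝ E₀ {g : G₀ | coAd (j g) z = z}

variable (E₀) in
/-- The complexification `(𝔤₀^z)^ℂ`, as a subspace of `𝔤 = 𝔤₀ ⊗ ℂ`. -/
noncomputable def complexifiedRealStabilizerAlgebra (j : G₀ →* G) (z : StrongDual ℂ E) :
    Submodule ℂ E :=
  ((realStabilizerAlgebra E₀ j z).baseChange ℂ).map (complexifiedDifferential E₀ E j)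

end RealForm

end CoadjointCR

/-!
The orbit map `g ↦ ρ g z₀` of a smooth representation has constant rank, because translating its
argument by `h` composes it with the linear automorphism `ρ h`. By the constant rank theorem a
linear projection `P` of the ambient space restricts to a chart of the orbit near each point, and
the orbit map becomes a submersion. The same normal form puts a smooth curve of stabilizer elements
through every vector that the differential of the orbit map kills, so the Lie algebra of a
stabilizer is the kernel of the infinitesimal action.

At a point of the real orbit let `B : 𝔤 → T M` be the infinitesimal action of `G` and
`D : 𝔤₀ → 𝔤` the differential of `j`. The real tangent space is `S = B (D 𝔤₀)`, and `𝔤₀^z` is the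
kernel of `B ∘ D`. As `D 𝔤₀` spans `𝔤` over `ℂ`, `S + i S` is the whole of `T M`, so the orbit is
generic. Hence `dim_ℂ ((S ⊗ ℂ) ∩ T^{1,0} M) = dim_ℝ S - dim_ℂ M`, and counting ranks of `B` and
`B ∘ D` shows that `𝔤^z / (𝔤₀^z)^ℂ` has the same dimension.
-/

namespace CoadjointCR

section RangeComp

variable {𝕜 : Type*} [Field 𝕜] {E E' V V' : Type*} [AddCommGroup E] [Module 𝕜 E]
  [AddCommGroup E'] [Module 𝕜 E'] [AddCommGroup V] [Module 𝕜 V] [FiniteDimensional 𝕜 V]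
  [AddCommGroup V'] [Module 𝕜 V']

theorem surjective_of_finrank_range_comp_eq {T : E →ₗ[𝕜] V} {A : V →ₗ[𝕜] V'}
    (h : Module.finrank 𝕜 (A ∘ₗ T).range = Module.finrank 𝕜 V) : Function.Surjective T := by
  rw [LinearMap.range_comp] at h
  exact LinearMap.range_eq_top.1 (Submodule.eq_top_of_finrank_eq
    ((Submodule.finrank_le _).antisymm (h ▸ Submodule.finrank_map_le A T.range)))

theorem finrank_range_comp_comp_le (T : E →ₗ[𝕜] V) (B : E' →ₗ[𝕜] E) (A : V →ₗ[𝕜] V') :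
    Module.finrank 𝕜 (A ∘ₗ T ∘ₗ B).range ≤ Module.finrank 𝕜 T.range := by
  rw [LinearMap.range_comp]
  exact (Submodule.finrank_map_le A _).trans
    (Submodule.finrank_mono (LinearMap.range_comp_le_range B T))

end RangeComp

section Rank

variable {𝕜 : Type*} [RCLike 𝕜]
  {E : Type*} [NormedAddCommGroup E] [NormedSpace 𝕜 E]
  {V : Type*} [NormedAddCommGroup V] [NormedSpace 𝕜 V]
  {F : Type*} [NormedAddCommGroup F] [NormedSpace 𝕜 F]

theorem exists_surjective_comp_of_finrank_range_eq [FiniteDimensional 𝕜 V]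
    [FiniteDimensional 𝕜 F] (D : E →L[𝕜] V)
    (hD : Module.finrank 𝕜 D.range = Module.finrank 𝕜 F) :
    ∃ P : V →L[𝕜] F, Function.Surjective (P ∘L D) := by
  obtain ⟨P, hP⟩ := LinearMap.exists_extend (LinearEquiv.ofFinrankEq D.range F hD).toLinearMap
  refine ⟨P.toContinuousLinearMap, fun a => ?_⟩
  obtain ⟨⟨_, x, rfl⟩, rfl⟩ := (LinearEquiv.ofFinrankEq D.range F hD).surjective a
  exact ⟨x, LinearMap.congr_fun hP ⟨D x, x, rfl⟩⟩

theorem ker_comp_eq_ker_of_finrank_range_le [FiniteDimensional 𝕜 E] (D : E →L[𝕜] V)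
    (P : V →L[𝕜] F) (hD : Module.finrank 𝕜 D.range ≤ Module.finrank 𝕜 F)
    (hP : Function.Surjective (P ∘L D)) : (P ∘L D).ker = D.ker := by
  refine (Submodule.eq_of_le_of_finrank_le (fun x (hx : D x = 0) => ?_) ?_).symm
  · simp [hx]
  · have hPD := (P ∘L D).toLinearMap.finrank_range_add_finrank_ker
    have hD' := D.toLinearMap.finrank_range_add_finrank_ker
    rw [LinearMap.range_eq_top.2 hP, finrank_top] at hPD
    omega

end Rank

section InverseFunction

variable {𝕜 : Type*} [RCLike 𝕜]
  {E : Type*} [NormedAddCommGroup E] [NormedSpace 𝕜 E] [CompleteSpace E]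
  {F : Type*} [NormedAddCommGroup F] [NormedSpace 𝕜 F]

theorem exists_openPartialHomeomorph_contDiffOn_symm {φ : E → F} {s : Set E} {y₀ : E} {n : ℕ∞ω}
    (hφ : ContDiffOn 𝕜 n φ s) (hs : s ∈ 𝓝 y₀) (hn : n ≠ 0) {e : E ≃L[𝕜] F}
    (he : HasFDerivAt φ (e : E →L[𝕜] F) y₀) :
    ∃ Φ : OpenPartialHomeomorph E F, y₀ ∈ Φ.source ∧ Φ.source ⊆ s ∧ ⇑Φ = φ ∧
      ContDiffOn 𝕜 n Φ.symm Φ.target := by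
  have hφ₀ : ContDiffAt 𝕜 n φ y₀ := hφ.contDiffAt hs
  have hinv : ∀ᶠ y in 𝓝 y₀, fderiv 𝕜 φ y ∈ Set.range ((↑) : (E ≃L[𝕜] F) → E →L[𝕜] F) := by
    have hn1 : (1 : ℕ∞ω) ≤ n := ENat.one_le_iff_ne_zero_withTop.2 hn
    have hcont : ContinuousAt (fderiv 𝕜 φ) y₀ :=
      (hφ₀.fderiv_right (m := 0) (by simpa using hn1)).continuousAt
    exact hcont (he.fderiv ▸ ContinuousLinearEquiv.nhds e)
  obtain ⟨O, hO, hO_open, hy₀O⟩ := eventually_nhds_iff.1 (hinv.and (eventually_mem_nhds_iff.2 hs))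
  let Φ₀ := hφ₀.toOpenPartialHomeomorph φ he hn
  refine ⟨Φ₀.restrOpen O hO_open, ⟨hφ₀.mem_toOpenPartialHomeomorph_source he hn, hy₀O⟩,
    fun y hy => mem_of_mem_nhds (hO y hy.2).2, rfl, fun w hw => ?_⟩
  obtain ⟨⟨e', he'⟩, hs'⟩ := hO _ ((Φ₀.restrOpen O hO_open).map_target hw).2
  have hφ' := hφ.contDiffAt hs'
  exact ((Φ₀.restrOpen O hO_open).contDiffAt_symm hw
    (he' ▸ (hφ'.differentiableAt hn).hasFDerivAt) hφ').contDiffWithinAt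

end InverseFunction

section Slice

variable {𝕜 : Type*} [RCLike 𝕜]
  {V : Type*} [NormedAddCommGroup V] [NormedSpace 𝕜 V]
  {F : Type*} [NormedAddCommGroup F] [NormedSpace 𝕜 F] [FiniteDimensional 𝕜 F]
  {K : Type*} [NormedAddCommGroup K] [NormedSpace 𝕜 K] [FiniteDimensional 𝕜 K]

theorem apply_prodMk_eq_of_finrank_range_fderiv_le {A : Set F} {B : Set K} (hA : IsOpen A)
    (hB : IsOpen B) (hB' : IsPreconnected B) {u : F × K → V} (hu : DifferentiableOn 𝕜 u (A ×ˢ B))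
    (P : V →L[𝕜] F) (hP : ∀ w ∈ A ×ˢ B, P (u w) = w.1)
    (hrank : ∀ w ∈ A ×ˢ B, Module.finrank 𝕜 (fderiv 𝕜 u w).range ≤ Module.finrank 𝕜 F)
    {a : F} (ha : a ∈ A) {b b' : K} (hb : b ∈ B) (hb' : b' ∈ B) : u (a, b) = u (a, b') := by
  have hderiv : ∀ c ∈ B, HasFDerivAt (fun c => u (a, c)) (0 : K →L[𝕜] V) c := by
    intro c hc
    have hmem : A ×ˢ B ∈ 𝓝 (a, c) := (hA.prod hB).mem_nhds ⟨ha, hc⟩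
    have hu' := (hu.differentiableAt hmem).hasFDerivAt
    have hfst : P ∘L fderiv 𝕜 u (a, c) = ContinuousLinearMap.fst 𝕜 F K :=
      (P.hasFDerivAt.comp (a, c) hu').unique (hasFDerivAt_fst.congr_of_eventuallyEq
        (Filter.eventuallyEq_of_mem hmem hP))
    have hker := ker_comp_eq_ker_of_finrank_range_le _ P (hrank (a, c) ⟨ha, hc⟩)
      (by rw [hfst]; exact Prod.fst_surjective)
    have hzero : fderiv 𝕜 u (a, c) ∘L ContinuousLinearMap.inr 𝕜 F K = 0 := by
      ext k
      have hk : ((0 : F), k) ∈ (fderiv 𝕜 u (a, c)).ker := by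
        rw [← hker, hfst]
        rfl
      exact hk
    exact hzero ▸ hu'.comp c (hasFDerivAt_prodMk_right a c)
  let _ : NormedSpace ℝ K := NormedSpace.restrictScalars ℝ 𝕜 K
  exact hB.is_const_of_fderiv_eq_zero hB'
    (fun c hc => (hderiv c hc).differentiableAt.differentiableWithinAt)
    (fun c hc => (hderiv c hc).fderiv) hb hb'

end Slice

section ModelDeriv

variable {𝕜 : Type*} [NontriviallyNormedField 𝕜]
  {E : Type*} [NormedAddCommGroup E] [NormedSpace 𝕜 E]
  {E' : Type*} [NormedAddCommGroup E'] [NormedSpace 𝕜 E']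
  {E'' : Type*} [NormedAddCommGroup E''] [NormedSpace 𝕜 E'']
  {N : Type*} [TopologicalSpace N] [ChartedSpace E N]
  {N' : Type*} [TopologicalSpace N'] [ChartedSpace E' N']
  {N'' : Type*} [TopologicalSpace N''] [ChartedSpace E'' N'']

variable (𝕜 E E') in
/-- The derivative of a map of manifolds, as a map between the model vector spaces: the tangent
spaces at different points are identified, so that derivatives at propositionally equal points can
be rewritten into each other. -/
noncomputable def modelDeriv (f : N → N') (x : N) : E →L[𝕜] E' :=
  (mfderiv 𝓘(𝕜, E) 𝓘(𝕜, E') f x : TangentSpace 𝓘(𝕜, E) x →L[𝕜] TangentSpace 𝓘(𝕜, E') (f x))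

theorem modelDeriv_comp {g : N' → N''} {f : N → N'} (x : N)
    (hg : MDifferentiableAt 𝓘(𝕜, E') 𝓘(𝕜, E'') g (f x))
    (hf : MDifferentiableAt 𝓘(𝕜, E) 𝓘(𝕜, E') f x) :
    modelDeriv 𝕜 E E'' (fun x => g (f x)) x =
      modelDeriv 𝕜 E' E'' g (f x) ∘L modelDeriv 𝕜 E E' f x :=
  mfderiv_comp x hg hf

theorem modelDeriv_congr {f g : N → N'} {x : N} (h : f =ᶠ[𝓝 x] g) :
    modelDeriv 𝕜 E E' f x = modelDeriv 𝕜 E E' g x :=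
  h.mfderiv_eq

theorem modelDeriv_id (x : N) : modelDeriv 𝕜 E E (fun x : N => x) x = ContinuousLinearMap.id 𝕜 E :=
  mfderiv_id

theorem modelDeriv_const (x : N) (c : N') : modelDeriv 𝕜 E E' (fun _ : N => c) x = 0 :=
  mfderiv_const

theorem modelDeriv_eq_fderiv (f : E → E') (x : E) : modelDeriv 𝕜 E E' f x = fderiv 𝕜 f x :=
  mfderiv_eq_fderiv

theorem modelDeriv_clm_comp (P : E' →L[𝕜] E'') {f : N → E'} {x : N}
    (hf : MDifferentiableAt 𝓘(𝕜, E) 𝓘(𝕜, E') f x) :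
    modelDeriv 𝕜 E E'' (fun x => P (f x)) x = P ∘L modelDeriv 𝕜 E E' f x := by
  rw [modelDeriv_comp x P.mdifferentiableAt hf, modelDeriv_eq_fderiv, P.fderiv]

theorem hasFDerivAt_comp_chart_symm {f : N → E'} {x : N}
    (hf : MDifferentiableAt 𝓘(𝕜, E) 𝓘(𝕜, E') f x) :
    HasFDerivAt (fun y => f ((chartAt E x).symm y)) (modelDeriv 𝕜 E E' f x) (chartAt E x x) := by
  have h := hf.hasMFDerivAt.2
  rw [modelWithCornersSelf_coe, Set.range_id] at h
  exact hasFDerivWithinAt_univ.1 h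

end ModelDeriv

section Box

variable {N F K : Type*} [TopologicalSpace N] [TopologicalSpace F] [TopologicalSpace K]

theorem exists_restr_target_eq_prod [LocallyConnectedSpace K]
    (Ψ : OpenPartialHomeomorph N (F × K)) {x₀ : N} (hx₀ : x₀ ∈ Ψ.source) :
    ∃ Ψ' : OpenPartialHomeomorph N (F × K), x₀ ∈ Ψ'.source ∧ ⇑Ψ' = Ψ ∧ ⇑Ψ'.symm = Ψ.symm ∧
      Ψ'.source ⊆ Ψ.source ∧
      ∃ A B, IsOpen A ∧ IsOpen B ∧ IsPreconnected B ∧ Ψ'.target = A ×ˢ B := by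
  obtain ⟨A, B₀, hA, hx₀A, hB₀, hx₀B₀, hAB₀⟩ := mem_nhds_prod_iff'.1
    (Ψ.open_target.mem_nhds (Ψ.map_source hx₀))
  let B := connectedComponentIn B₀ (Ψ x₀).2
  have hB : IsOpen B := hB₀.connectedComponentIn
  have hx₀AB : Ψ x₀ ∈ A ×ˢ B := ⟨hx₀A, mem_connectedComponentIn hx₀B₀⟩
  have hAB : A ×ˢ B ⊆ Ψ.target :=
    (Set.prod_mono_right (connectedComponentIn_subset _ _)).trans hAB₀
  let Ψ' := (Ψ.symm.restrOpen (A ×ˢ B) (hA.prod hB)).symm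
  have htarget : Ψ'.target = A ×ˢ B := Set.inter_eq_right.2 hAB
  refine ⟨Ψ', ?_, rfl, rfl, fun x hx => ?_, A, B, hA, hB, isPreconnected_connectedComponentIn,
    htarget⟩
  · rw [← Ψ.left_inv hx₀]
    exact Ψ'.map_target (htarget ▸ hx₀AB)
  · rw [← Ψ'.left_inv hx]
    exact Ψ.map_target (hAB (htarget ▸ Ψ'.map_source hx))

end Box

section SubmersionChart

variable {𝕜 : Type*} [RCLike 𝕜]
  {E : Type*} [NormedAddCommGroup E] [NormedSpace 𝕜 E]
  {F : Type*} [NormedAddCommGroup F] [NormedSpace 𝕜 F]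
  {K : Type*} [NormedAddCommGroup K] [NormedSpace 𝕜 K]
  {N : Type*} [TopologicalSpace N] [ChartedSpace E N]

variable (𝕜 E) in
/-- `Ψ` is a local coordinate system of `N` whose first coordinate is the map `g : N → F`. Its
values form a box `A × B ⊆ F × K` with `B` connected, so that `g` has connected level sets in the
domain of `Ψ`. -/
structure IsSubmersionChart (g : N → F) (Ψ : OpenPartialHomeomorph N (F × K)) : Prop where
  contMDiffOn : ContMDiffOn 𝓘(𝕜, E) 𝓘(𝕜, F × K) ∞ Ψ Ψ.source
  contMDiffOn_symm : ContMDiffOn 𝓘(𝕜, F × K) 𝓘(𝕜, E) ∞ Ψ.symm Ψ.target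
  fst_apply : ∀ x ∈ Ψ.source, (Ψ x).1 = g x
  target_eq_prod : ∃ A B, IsOpen A ∧ IsOpen B ∧ IsPreconnected B ∧ Ψ.target = A ×ˢ B

theorem exists_isSubmersionChart [IsManifold 𝓘(𝕜, E) ∞ N] [FiniteDimensional 𝕜 F]
    [CompleteSpace E] {g : N → F} (hg : ContMDiff 𝓘(𝕜, E) 𝓘(𝕜, F) ∞ g) {x₀ : N}
    (hx₀ : Function.Surjective (modelDeriv 𝕜 E F g x₀)) :
    ∃ Ψ : OpenPartialHomeomorph N (F × (modelDeriv 𝕜 E F g x₀).ker),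
      x₀ ∈ Ψ.source ∧ IsSubmersionChart 𝕜 E g Ψ := by
  set T := modelDeriv 𝕜 E F g x₀
  set φ := chartAt E x₀
  have hcomplete : CompleteSpace F := FiniteDimensional.complete 𝕜 F
  have hcomplete' : CompleteSpace T.ker := T.isClosed_ker.completeSpace_coe
  obtain ⟨Q, hQ⟩ := T.ker_closedComplemented_of_finiteDimensional_range
  let e := T.equivProdOfSurjectiveOfIsCompl Q (LinearMap.range_eq_top.2 hx₀)
    (LinearMap.range_eq_of_proj hQ) (LinearMap.isCompl_of_proj hQ)
  obtain ⟨Φ, hx₀Φ, -, hΦ, hΦ_symm⟩ := exists_openPartialHomeomorph_contDiffOn_symm (𝕜 := 𝕜)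
    (n := ∞) (e := e) (φ := fun y => (g (φ.symm y), Q y)) (s := φ.target)
    ((contMDiffOn_iff_contDiffOn.1 (hg.comp_contMDiffOn contMDiffOn_chart_symm)).prodMk
      Q.contDiff.contDiffOn)
    (φ.open_target.mem_nhds (mem_chart_target E x₀)) (by simp)
    ((hasFDerivAt_comp_chart_symm (hg.mdifferentiableAt (by simp))).prodMk Q.hasFDerivAt)
  let _ : NormedSpace ℝ T.ker := NormedSpace.restrictScalars ℝ 𝕜 T.ker
  let Ψ₀ := φ.trans Φ
  have hx₀Ψ₀ : x₀ ∈ Ψ₀.source := ⟨mem_chart_source E x₀, hx₀Φ⟩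
  obtain ⟨Ψ, hx₀Ψ, hΨ, hΨ_symm, hΨ₀, hbox⟩ := exists_restr_target_eq_prod Ψ₀ hx₀Ψ₀
  have hΨφ : Ψ.source ⊆ φ.source := fun x hx => (hΨ₀ hx).1
  have happly : ∀ x ∈ Ψ.source, Ψ x = (g x, Q (φ x)) := fun x hx => by
    have hx' : Φ (φ x) = (g (φ.symm (φ x)), Q (φ x)) := congrFun hΦ (φ x)
    rw [hΨ]
    exact hx'.trans (by rw [φ.left_inv (hΨφ hx)])
  refine ⟨Ψ, hx₀Ψ, ⟨?_, ?_, fun x hx => by rw [happly x hx], hbox⟩⟩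
  · refine ContMDiffOn.congr ?_ happly
    exact hg.contMDiffOn.prodMk_space
      (Q.contMDiff.comp_contMDiffOn (contMDiffOn_chart.mono hΨφ))
  · have htarget : ∀ w ∈ Ψ.target, w ∈ Ψ₀.target := fun w hw => by
      rw [← Ψ.right_inv hw, hΨ]
      exact Ψ₀.map_source (hΨ₀ (Ψ.map_target hw))
    rw [hΨ_symm]
    exact contMDiffOn_chart_symm.comp
      ((contMDiffOn_iff_contDiffOn.2 hΦ_symm).mono fun w hw => (htarget w hw).1)
      fun w hw => (htarget w hw).2

variable {g : N → F} {Ψ : OpenPartialHomeomorph N (F × K)} {x₀ : N}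

namespace IsSubmersionChart

theorem apply_symm_eq_fst (hΨ : IsSubmersionChart 𝕜 E g Ψ) {w : F × K} (hw : w ∈ Ψ.target) :
    g (Ψ.symm w) = w.1 := by
  rw [← hΨ.fst_apply _ (Ψ.map_target hw), Ψ.right_inv hw]

theorem exists_contMDiffOn_section (hΨ : IsSubmersionChart 𝕜 E g Ψ) (hx₀ : x₀ ∈ Ψ.source) :
    IsOpen (g '' Ψ.source) ∧ ∃ σ : F → N, ContMDiffOn 𝓘(𝕜, F) 𝓘(𝕜, E) ∞ σ (g '' Ψ.source) ∧
      ∀ a ∈ g '' Ψ.source, σ a ∈ Ψ.source ∧ g (σ a) = a := by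
  obtain ⟨A, B, hA, -, -, htarget⟩ := hΨ.target_eq_prod
  have hx₀B : (Ψ x₀).2 ∈ B := (htarget ▸ Ψ.map_source hx₀ : Ψ x₀ ∈ A ×ˢ B).2
  have hmem : ∀ a ∈ A, (a, (Ψ x₀).2) ∈ Ψ.target := fun a ha => htarget ▸ ⟨ha, hx₀B⟩
  have himage : g '' Ψ.source = A := by
    refine Set.Subset.antisymm ?_ fun a ha =>
      ⟨Ψ.symm (a, (Ψ x₀).2), Ψ.map_target (hmem a ha), hΨ.apply_symm_eq_fst (hmem a ha)⟩
    rintro _ ⟨x, hx, rfl⟩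
    exact hΨ.fst_apply x hx ▸ (htarget ▸ Ψ.map_source hx : Ψ x ∈ A ×ˢ B).1
  rw [himage]
  exact ⟨hA, fun a => Ψ.symm (a, (Ψ x₀).2),
    hΨ.contMDiffOn_symm.comp (contMDiff_id.prodMk_space contMDiff_const).contMDiffOn hmem,
    fun a ha => ⟨Ψ.map_target (hmem a ha), hΨ.apply_symm_eq_fst (hmem a ha)⟩⟩

theorem exists_curve_of_modelDeriv_eq_zero (hΨ : IsSubmersionChart 𝕜 E g Ψ)
    (hx₀ : x₀ ∈ Ψ.source) {v : E} (hv : modelDeriv 𝕜 E F g x₀ v = 0) :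
    ∃ γ : 𝕜 → N, γ 0 = x₀ ∧ ContMDiffAt 𝓘(𝕜, 𝕜) 𝓘(𝕜, E) ∞ γ 0 ∧
      (∀ᶠ t in 𝓝 0, γ t ∈ Ψ.source ∧ g (γ t) = g x₀) ∧ modelDeriv 𝕜 𝕜 E γ 0 1 = v := by
  have hsource : Ψ.source ∈ 𝓝 x₀ := Ψ.open_source.mem_nhds hx₀
  have hΨx₀ : MDifferentiableAt 𝓘(𝕜, E) 𝓘(𝕜, F × K) Ψ x₀ :=
    (hΨ.contMDiffOn.contMDiffAt hsource).mdifferentiableAt (by simp)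
  set v' : F × K := modelDeriv 𝕜 E (F × K) Ψ x₀ v with hv'
  have hv'₁ : v'.1 = 0 := by
    have hfst := modelDeriv_clm_comp (ContinuousLinearMap.fst 𝕜 F K) hΨx₀
    have hg : (fun x => (Ψ x).1) =ᶠ[𝓝 x₀] g := Filter.eventuallyEq_of_mem hsource hΨ.fst_apply
    rw [← hv, ← modelDeriv_congr hg]
    exact (DFunLike.congr_fun hfst v).symm
  let l : 𝕜 → F × K := fun t => Ψ x₀ + t • v'
  have hl : ContDiff 𝕜 ∞ l := contDiff_const.add (contDiff_id.smul contDiff_const)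
  have hl₀ : l 0 = Ψ x₀ := by simp [l]
  have hl' : modelDeriv 𝕜 𝕜 (F × K) l 0 1 = v' := by
    rw [modelDeriv_eq_fderiv, fderiv_apply_one_eq_deriv]
    exact (((hasDerivAt_id (0 : 𝕜)).smul_const v').const_add (Ψ x₀)).deriv.trans (one_smul 𝕜 v')
  have htarget : Ψ.target ∈ 𝓝 (l 0) := hl₀ ▸ Ψ.open_target.mem_nhds (Ψ.map_source hx₀)
  have hsymm := hΨ.contMDiffOn_symm.contMDiffAt htarget
  have hγ₀ : Ψ.symm (l 0) = x₀ := by rw [hl₀, Ψ.left_inv hx₀]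
  refine ⟨fun t => Ψ.symm (l t), hγ₀, hsymm.comp 0 hl.contMDiff.contMDiffAt, ?_, ?_⟩
  · filter_upwards [hl.continuous.continuousAt htarget] with t ht
    refine ⟨Ψ.map_target ht, ?_⟩
    rw [hΨ.apply_symm_eq_fst ht, ← hΨ.fst_apply x₀ hx₀]
    simp [l, hv'₁]
  · have hleft : modelDeriv 𝕜 (F × K) E Ψ.symm (l 0) ∘L modelDeriv 𝕜 E (F × K) Ψ x₀ =
        ContinuousLinearMap.id 𝕜 E := by
      rw [hl₀, ← modelDeriv_comp x₀ (hl₀ ▸ hsymm.mdifferentiableAt (by simp)) hΨx₀,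
        modelDeriv_congr (Filter.eventuallyEq_of_mem hsource fun x hx => Ψ.left_inv hx),
        modelDeriv_id]
    rw [modelDeriv_comp 0 (hsymm.mdifferentiableAt (by simp))
      (hl.contMDiff.mdifferentiableAt (by simp)), ContinuousLinearMap.comp_apply, hl', hv']
    exact DFunLike.congr_fun hleft v

end IsSubmersionChart

end SubmersionChart

section ConstantRank

variable {𝕜 : Type*} [RCLike 𝕜]
  {E : Type*} [NormedAddCommGroup E] [NormedSpace 𝕜 E] [FiniteDimensional 𝕜 E]
  {V : Type*} [NormedAddCommGroup V] [NormedSpace 𝕜 V]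
  {F : Type*} [NormedAddCommGroup F] [NormedSpace 𝕜 F] [FiniteDimensional 𝕜 F]
  {N : Type*} [TopologicalSpace N] [ChartedSpace E N]

theorem IsSubmersionChart.apply_eq_of_finrank_range_le
    {K : Type*} [NormedAddCommGroup K] [NormedSpace 𝕜 K] [FiniteDimensional 𝕜 K]
    {Ψ : OpenPartialHomeomorph N (F × K)} {f : N → V} {P : V →L[𝕜] F}
    (hΨ : IsSubmersionChart 𝕜 E (fun x => P (f x)) Ψ) (hf : ContMDiff 𝓘(𝕜, E) 𝓘(𝕜, V) ∞ f)
    (hrank : ∀ x, Module.finrank 𝕜 (modelDeriv 𝕜 E V f x).range ≤ Module.finrank 𝕜 F)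
    {x x' : N} (hx : x ∈ Ψ.source) (hx' : x' ∈ Ψ.source) (hxx' : P (f x) = P (f x')) :
    f x = f x' := by
  obtain ⟨A, B, hA, hB, hB', htarget⟩ := hΨ.target_eq_prod
  have hsymm : ∀ w ∈ A ×ˢ B, MDifferentiableAt 𝓘(𝕜, F × K) 𝓘(𝕜, E) Ψ.symm w := fun w hw =>
    (hΨ.contMDiffOn_symm.contMDiffAt (Ψ.open_target.mem_nhds (htarget ▸ hw))).mdifferentiableAt
      (by simp)
  have hf' : MDifferentiable 𝓘(𝕜, E) 𝓘(𝕜, V) f := hf.mdifferentiable (by simp)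
  have hbox : ∀ y ∈ Ψ.source, ((Ψ y).1, (Ψ y).2) ∈ A ×ˢ B := fun y hy =>
    htarget ▸ Ψ.map_source hy
  have hslice : f (Ψ.symm ((Ψ x).1, (Ψ x).2)) = f (Ψ.symm ((Ψ x).1, (Ψ x').2)) := by
    refine apply_prodMk_eq_of_finrank_range_fderiv_le (𝕜 := 𝕜) hA hB hB'
      (u := fun w => f (Ψ.symm w)) (fun w hw => ?_) P
      (fun w hw => hΨ.apply_symm_eq_fst (htarget ▸ hw)) (fun w hw => ?_)
      (hbox x hx).1 (hbox x hx).2 (hbox x' hx').2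
    · exact ((hf' _).comp w (hsymm w hw)).differentiableAt.differentiableWithinAt
    · rw [← modelDeriv_eq_fderiv, modelDeriv_comp w (hf' _) (hsymm w hw)]
      exact (Submodule.finrank_mono (LinearMap.range_comp_le_range _ _)).trans (hrank _)
  have hfst : (Ψ x).1 = (Ψ x').1 := by rw [hΨ.fst_apply x hx, hΨ.fst_apply x' hx', hxx']
  calc
    f x = f (Ψ.symm ((Ψ x).1, (Ψ x).2)) := by rw [Prod.mk.eta, Ψ.left_inv hx]
    _ = f (Ψ.symm ((Ψ x).1, (Ψ x').2)) := hslice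
    _ = f x' := by rw [hfst, Prod.mk.eta, Ψ.left_inv hx']

theorem exists_isSubmersionChart_of_finrank_range_eq [FiniteDimensional 𝕜 V]
    [IsManifold 𝓘(𝕜, E) ∞ N] {f : N → V}
    (hf : ContMDiff 𝓘(𝕜, E) 𝓘(𝕜, V) ∞ f)
    (hrank : ∀ x, Module.finrank 𝕜 (modelDeriv 𝕜 E V f x).range = Module.finrank 𝕜 F) (x₀ : N) :
    ∃ (P : V →L[𝕜] F)
      (Ψ : OpenPartialHomeomorph N (F × (modelDeriv 𝕜 E F (fun x => P (f x)) x₀).ker)),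
      x₀ ∈ Ψ.source ∧ IsSubmersionChart 𝕜 E (fun x => P (f x)) Ψ ∧
        ∀ x ∈ Ψ.source, ∀ x' ∈ Ψ.source, P (f x) = P (f x') → f x = f x' := by
  obtain ⟨P, hP⟩ := exists_surjective_comp_of_finrank_range_eq _ (hrank x₀)
  have hcomplete : CompleteSpace E := FiniteDimensional.complete 𝕜 E
  obtain ⟨Ψ, hx₀, hΨ⟩ := exists_isSubmersionChart (P.contMDiff.comp hf)
    (by rwa [Function.comp_def, modelDeriv_clm_comp P (hf.mdifferentiableAt (by simp))])
  exact ⟨P, Ψ, hx₀, hΨ, fun x hx x' hx' =>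
    hΨ.apply_eq_of_finrank_range_le hf (fun x => (hrank x).le) hx hx'⟩

end ConstantRank

section ImageManifold

variable {𝕜 : Type*} [RCLike 𝕜]
  {E : Type*} [NormedAddCommGroup E] [NormedSpace 𝕜 E]
  {V : Type*} [NormedAddCommGroup V] [NormedSpace 𝕜 V]
  {F : Type*} [NormedAddCommGroup F] [NormedSpace 𝕜 F]
  {N : Type*} [TopologicalSpace N] [ChartedSpace E N]
  {X : Type*} [TopologicalSpace X]
  {p : N → X} {i : X → V}

variable (𝕜 E) in
/-- A chart `e` of the image `X` of a map `i ∘ p : N → V` of constant rank: it is a linear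
projection of `V` restricted to `X`, and its inverse factors through a smooth local section `σ`
of the projection. -/
structure IsProjectionChart (p : N → X) (i : X → V) (e : OpenPartialHomeomorph X F) : Prop where
  exists_apply_eq : ∃ P : V →L[𝕜] F, ∀ z, e z = P (i z)
  exists_symm_eq : ∃ σ : F → N, ContMDiffOn 𝓘(𝕜, F) 𝓘(𝕜, E) ∞ σ e.target ∧
    ∀ a ∈ e.target, e.symm a = p (σ a)

theorem exists_isProjectionChart [IsManifold 𝓘(𝕜, E) ∞ N] [FiniteDimensional 𝕜 E]
    [FiniteDimensional 𝕜 V] [FiniteDimensional 𝕜 F] (hp : IsOpenQuotientMap p)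
    (hi : Function.Injective i) (hf : ContMDiff 𝓘(𝕜, E) 𝓘(𝕜, V) ∞ fun x => i (p x))
    (hrank : ∀ x, Module.finrank 𝕜 (modelDeriv 𝕜 E V (fun x => i (p x)) x).range =
      Module.finrank 𝕜 F) (z : X) :
    ∃ e : OpenPartialHomeomorph X F, z ∈ e.source ∧ IsProjectionChart 𝕜 E p i e := by
  obtain ⟨x₀, rfl⟩ := hp.surjective z
  obtain ⟨P, Ψ, hx₀, hΨ, hΨf⟩ := exists_isSubmersionChart_of_finrank_range_eq hf hrank x₀
  obtain ⟨hopen, σ, hσ, hσP⟩ := hΨ.exists_contMDiffOn_section hx₀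
  have hcont : Continuous fun z => P (i z) :=
    P.continuous.comp (hp.isQuotientMap.continuous_iff.2 hf.continuous)
  refine ⟨{
    toFun := fun z => P (i z)
    invFun := fun a => p (σ a)
    source := p '' Ψ.source
    target := (fun x => P (i (p x))) '' Ψ.source
    map_source' := ?_
    map_target' := fun a ha => ⟨σ a, (hσP a ha).1, rfl⟩
    left_inv' := ?_
    right_inv' := fun a ha => (hσP a ha).2
    open_source := hp.isOpenMap _ Ψ.open_source
    open_target := hopen
    continuousOn_toFun := hcont.continuousOn
    continuousOn_invFun := hp.continuous.comp_continuousOn hσ.continuousOn },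
    ⟨x₀, hx₀, rfl⟩, ⟨P, fun _ => rfl⟩, σ, hσ, fun _ _ => rfl⟩
  · rintro _ ⟨x, hx, rfl⟩
    exact ⟨x, hx, rfl⟩
  · rintro _ ⟨x, hx, rfl⟩
    obtain ⟨hσx, hPσ⟩ := hσP _ ⟨x, hx, rfl⟩
    exact hi (hΨf _ hσx x hx hPσ)

theorem exists_chartedSpace_isProjectionChart [IsManifold 𝓘(𝕜, E) ∞ N] [FiniteDimensional 𝕜 E]
    [FiniteDimensional 𝕜 V] [FiniteDimensional 𝕜 F] (hp : IsOpenQuotientMap p)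
    (hi : Function.Injective i) (hf : ContMDiff 𝓘(𝕜, E) 𝓘(𝕜, V) ∞ fun x => i (p x))
    (hrank : ∀ x, Module.finrank 𝕜 (modelDeriv 𝕜 E V (fun x => i (p x)) x).range =
      Module.finrank 𝕜 F) :
    ∃ _ : ChartedSpace F X, ∀ e ∈ atlas F X, IsProjectionChart 𝕜 E p i e := by
  choose e hmem he using exists_isProjectionChart hp hi hf hrank
  exact ⟨{
    atlas := Set.range e
    chartAt := e
    mem_chart_source := hmem
    chart_mem_atlas := fun z => ⟨z, rfl⟩ }, Set.forall_mem_range.2 he⟩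

variable [ChartedSpace F X]

theorem isManifold_of_isProjectionChart (hX : ∀ e ∈ atlas F X, IsProjectionChart 𝕜 E p i e)
    (hf : ContMDiff 𝓘(𝕜, E) 𝓘(𝕜, V) ∞ fun x => i (p x)) : IsManifold 𝓘(𝕜, F) ∞ X := by
  refine isManifold_of_contDiffOn _ _ _ fun e e' he he' => ?_
  obtain ⟨σ, hσ, hσe⟩ := (hX e he).exists_symm_eq
  obtain ⟨P, hP⟩ := (hX e' he').exists_apply_eq
  have htransition : ContDiffOn 𝕜 ∞ (fun a => P (i (p (σ a)))) e.target :=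
    contMDiffOn_iff_contDiffOn.1 ((P.contMDiff.comp hf).comp_contMDiffOn hσ)
  simp only [modelWithCornersSelf_coe, modelWithCornersSelf_coe_symm, Function.comp_id,
    Function.id_comp, Set.preimage_id, Set.range_id, Set.inter_univ]
  refine (htransition.mono fun a ha => ha.1).congr fun a ha => ?_
  rw [OpenPartialHomeomorph.trans_apply, hP, hσe a ha.1]

theorem contMDiff_of_isProjectionChart [IsManifold 𝓘(𝕜, F) ∞ X]
    (hX : ∀ e ∈ atlas F X, IsProjectionChart 𝕜 E p i e)
    (hf : ContMDiff 𝓘(𝕜, E) 𝓘(𝕜, V) ∞ fun x => i (p x)) :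
    ContMDiff 𝓘(𝕜, F) 𝓘(𝕜, V) ∞ i := by
  intro z
  obtain ⟨σ, hσ, hσe⟩ := (hX _ (chart_mem_atlas F z)).exists_symm_eq
  have hcomp : ContMDiffOn 𝓘(𝕜, F) 𝓘(𝕜, V) ∞ (fun x => i (p (σ (chartAt F z x))))
      (chartAt F z).source :=
    (hf.comp_contMDiffOn hσ).comp contMDiffOn_chart (chartAt F z).mapsTo
  refine (hcomp.congr fun x hx => ?_).contMDiffAt (chart_source_mem_nhds F z)
  rw [← hσe _ ((chartAt F z).map_source hx), (chartAt F z).left_inv hx]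

theorem isSubmanifold_of_isProjectionChart [IsManifold 𝓘(𝕜, F) ∞ X] (hi : Function.Injective i)
    (hX : ∀ e ∈ atlas F X, IsProjectionChart 𝕜 E p i e)
    (hf : ContMDiff 𝓘(𝕜, E) 𝓘(𝕜, V) ∞ fun x => i (p x)) : IsSubmanifold 𝕜 F V i := by
  have hsmooth := contMDiff_of_isProjectionChart hX hf
  refine ⟨hsmooth, hi, fun z => ?_⟩
  obtain ⟨P, hP⟩ := (hX _ (chart_mem_atlas F z)).exists_apply_eq
  have hderiv := P.hasFDerivAt.comp _
    (hasFDerivAt_comp_chart_symm (hsmooth.mdifferentiableAt (x := z) (by simp)))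
  have hinv : (fun a => P (i ((chartAt F z).symm a))) =ᶠ[𝓝 (chartAt F z z)] id := by
    filter_upwards [chart_target_mem_nhds F z] with a ha
    rw [← hP, (chartAt F z).right_inv ha, id]
  have hleft := hderiv.unique ((hasFDerivAt_id _).congr_of_eventuallyEq hinv)
  exact Function.LeftInverse.injective fun v => DFunLike.congr_fun hleft v

theorem contMDiff_of_comp_of_isProjectionChart
    {𝕜' : Type*} [NontriviallyNormedField 𝕜'] [NormedSpace 𝕜' V] [NormedSpace 𝕜' F]
    [LinearMap.CompatibleSMul V F 𝕜' 𝕜] {E' : Type*} [NormedAddCommGroup E'] [NormedSpace 𝕜' E']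
    {L : Type*} [TopologicalSpace L] [ChartedSpace E' L]
    (hX : ∀ e ∈ atlas F X, IsProjectionChart 𝕜 E p i e) {ι : L → X} (hι : Continuous ι)
    (hi : ContMDiff 𝓘(𝕜', E') 𝓘(𝕜', V) ∞ fun y => i (ι y)) :
    ContMDiff 𝓘(𝕜', E') 𝓘(𝕜', F) ∞ ι := by
  intro y
  obtain ⟨P, hP⟩ := (hX _ (chart_mem_atlas F (ι y))).exists_apply_eq
  refine contMDiffAt_iff_target.2 ⟨hι.continuousAt, ?_⟩
  have hcomp : (extChartAt 𝓘(𝕜', F) (ι y) ∘ ι) = fun y' => P.restrictScalars 𝕜' (i (ι y')) :=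
    funext fun y' => hP (ι y')
  rw [hcomp]
  exact (P.restrictScalars 𝕜').contMDiff.contMDiffAt.comp y (hi y)

end ImageManifold

section OpenOrbitMap

theorem isOpenQuotientMap_coinduced {G X : Type*} [TopologicalSpace G] [Group G] [ContinuousMul G]
    {p : G → X} (hp : Function.Surjective p)
    (hmul : ∀ h g g', p g = p g' → p (h * g) = p (h * g')) :
    letI := TopologicalSpace.coinduced p inferInstance
    IsOpenQuotientMap p := by
  let _ := TopologicalSpace.coinduced p inferInstance
  refine ⟨hp, continuous_coinduced_rng, fun U hU => ?_⟩
  refine isOpen_coinduced.2 (isOpen_iff_mem_nhds.2 fun g hg => ?_)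
  obtain ⟨u, hu, hug⟩ := hg
  have hcont : Continuous fun g' => g' * (g⁻¹ * u) := continuous_mul_const _
  filter_upwards [hcont.continuousAt.preimage_mem_nhds (t := U) (hU.mem_nhds (by simpa using hu))]
    with g' hg'
  refine ⟨g' * (g⁻¹ * u), hg', ?_⟩
  have h := hmul (g' * g⁻¹) u g hug
  simpa only [mul_assoc, inv_mul_cancel, mul_one] using h

end OpenOrbitMap

section StabilizerLieAlgebra

variable (𝕜 : Type*) [NontriviallyNormedField 𝕜]
  (E : Type*) [NormedAddCommGroup E] [NormedSpace 𝕜 E]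
  {V : Type*} [NormedAddCommGroup V] [NormedSpace 𝕜 V]
  {G : Type*} [TopologicalSpace G] [ChartedSpace E G] [Group G]

/-- The Lie algebra of the stabilizer of a vector under a representation; `stabilizerAlgebra` and
`realStabilizerAlgebra` are the cases of the coadjoint representation and of its restriction to
a real form. -/
noncomputable def stabilizerLieAlgebra (ρ : G →* (V →L[𝕜] V)) (z : V) : Submodule 𝕜 E :=
  subgroupLieAlgebra 𝕜 E {g | ρ g z = z}

end StabilizerLieAlgebra

section Representation

variable {𝕜 : Type*} [RCLike 𝕜]
  {E : Type*} [NormedAddCommGroup E] [NormedSpace 𝕜 E]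
  {V : Type*} [NormedAddCommGroup V] [NormedSpace 𝕜 V]
  {G : Type*} [TopologicalSpace G] [ChartedSpace E G] [Group G] [LieGroup 𝓘(𝕜, E) ∞ G]
  {ρ : G →* (V →L[𝕜] V)} {z : V}

theorem modelDeriv_orbit_mul (hρ : ContMDiff 𝓘(𝕜, E) 𝓘(𝕜, V) ∞ fun g => ρ g z) (h g : G) :
    modelDeriv 𝕜 E V (fun g => ρ g z) g = ρ h⁻¹ ∘L modelDeriv 𝕜 E V (fun g => ρ g z) (h * g) ∘L
      modelDeriv 𝕜 E E (fun g => h * g) g := by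
  have horbit : (fun g => ρ g z) = fun g => ρ h⁻¹ (ρ (h * g) z) := by
    funext g
    rw [← mul_apply_eq_comp, ← map_mul, inv_mul_cancel_left]
  have hleft : ContMDiff 𝓘(𝕜, E) 𝓘(𝕜, E) ∞ fun g : G => h * g := contMDiff_mul_left
  have hρleft : ContMDiff 𝓘(𝕜, E) 𝓘(𝕜, V) ∞ fun g => ρ (h * g) z := hρ.comp hleft
  rw [← modelDeriv_comp g (hρ.mdifferentiableAt (by simp)) (hleft.mdifferentiableAt (by simp)),
    ← modelDeriv_clm_comp _ (hρleft.mdifferentiableAt (by simp)), ← horbit]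

variable [FiniteDimensional 𝕜 V]

theorem finrank_range_modelDeriv_orbit (hρ : ContMDiff 𝓘(𝕜, E) 𝓘(𝕜, V) ∞ fun g => ρ g z)
    (g h : G) : Module.finrank 𝕜 (modelDeriv 𝕜 E V (fun g => ρ g z) g).range =
      Module.finrank 𝕜 (modelDeriv 𝕜 E V (fun g => ρ g z) h).range := by
  have hle : ∀ g h : G, Module.finrank 𝕜 (modelDeriv 𝕜 E V (fun g => ρ g z) g).range ≤
      Module.finrank 𝕜 (modelDeriv 𝕜 E V (fun g => ρ g z) h).range := fun g h => by
    rw [modelDeriv_orbit_mul hρ (h * g⁻¹) g, inv_mul_cancel_right]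
    exact finrank_range_comp_comp_le _ _ _
  exact (hle g h).antisymm (hle h g)

theorem stabilizerLieAlgebra_eq_ker [FiniteDimensional 𝕜 E]
    (hρ : ContMDiff 𝓘(𝕜, E) 𝓘(𝕜, V) ∞ fun g => ρ g z) :
    stabilizerLieAlgebra 𝕜 E ρ z = (modelDeriv 𝕜 E V (fun g => ρ g z) 1).ker := by
  have hρ₁ : ρ 1 z = z := by simp
  refine le_antisymm (Submodule.span_le.2 ?_) fun v hv => Submodule.subset_span ?_
  · rintro _ ⟨γ, hγ₀, hγ, hγz, rfl⟩
    have hcomp := modelDeriv_comp 0 (hρ.mdifferentiable (by simp) (γ 0))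
      (hγ.mdifferentiableAt (by simp))
    rw [modelDeriv_congr (g := fun _ => z) hγz, modelDeriv_const, hγ₀] at hcomp
    exact (DFunLike.congr_fun hcomp 1).symm
  · obtain ⟨P, Ψ, hmem, hΨ, hΨρ⟩ := exists_isSubmersionChart_of_finrank_range_eq
      (F := (modelDeriv 𝕜 E V (fun g => ρ g z) 1).range) hρ
      (fun g => finrank_range_modelDeriv_orbit hρ g 1) 1
    have hPv : modelDeriv 𝕜 E (modelDeriv 𝕜 E V (fun g => ρ g z) 1).range
        (fun g => P (ρ g z)) 1 v = 0 := by
      rw [modelDeriv_clm_comp P (hρ.mdifferentiableAt (by simp)), ContinuousLinearMap.comp_apply,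
        show modelDeriv 𝕜 E V (fun g => ρ g z) 1 v = 0 from hv, map_zero]
    obtain ⟨γ, hγ₀, hγ, hγP, hγv⟩ := hΨ.exists_curve_of_modelDeriv_eq_zero hmem hPv
    exact ⟨γ, hγ₀, hγ, hγP.mono fun t ht => (hΨρ _ ht.1 _ hmem ht.2).trans hρ₁, hγv⟩

end Representation

section OrbitFactorization

variable {𝕜 : Type*} [RCLike 𝕜]
  {E : Type*} [NormedAddCommGroup E] [NormedSpace 𝕜 E]
  {V : Type*} [NormedAddCommGroup V] [NormedSpace 𝕜 V]
  {F : Type*} [NormedAddCommGroup F] [NormedSpace 𝕜 F]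
  {G : Type*} [Group G] {X : Type*} {ρ : G →* (V →L[𝕜] V)} {z₀ : V} {p : G → X} {i : X → V}

/-- `X` is a model of the orbit `G(z₀)` as a set, with orbit map `p` and inclusion `i` into `V`. -/
structure IsOrbitFactorization (ρ : G →* (V →L[𝕜] V)) (z₀ : V) (p : G → X) (i : X → V) :
    Prop where
  surjective : Function.Surjective p
  injective : Function.Injective i
  apply : ∀ g, i (p g) = ρ g z₀

namespace IsOrbitFactorization

theorem apply_mul (hp : IsOrbitFactorization ρ z₀ p i) (h g : G) :
    i (p (h * g)) = ρ h (i (p g)) := by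
  rw [hp.apply, hp.apply, map_mul, mul_apply_eq_comp]

theorem mul_eq_mul (hp : IsOrbitFactorization ρ z₀ p i) (h g g' : G) (hg : p g = p g') :
    p (h * g) = p (h * g') :=
  hp.injective (by rw [hp.apply_mul, hp.apply_mul, hg])

variable [TopologicalSpace G] [ChartedSpace E G]

theorem contMDiff_comp (hp : IsOrbitFactorization ρ z₀ p i)
    (hρ : ContMDiff 𝓘(𝕜, E) 𝓘(𝕜, V) ∞ fun g => ρ g z₀) :
    ContMDiff 𝓘(𝕜, E) 𝓘(𝕜, V) ∞ fun g => i (p g) := by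
  simpa only [hp.apply] using hρ

variable [LieGroup 𝓘(𝕜, E) ∞ G] [FiniteDimensional 𝕜 V]

theorem finrank_range_modelDeriv (hp : IsOrbitFactorization ρ z₀ p i)
    (hρ : ContMDiff 𝓘(𝕜, E) 𝓘(𝕜, V) ∞ fun g => ρ g z₀) (g : G) :
    Module.finrank 𝕜 (modelDeriv 𝕜 E V (fun g => i (p g)) g).range =
      Module.finrank 𝕜 (modelDeriv 𝕜 E V (fun g => ρ g z₀) 1).range := by
  rw [funext hp.apply]
  exact finrank_range_modelDeriv_orbit hρ g 1

theorem exists_chartedSpace [FiniteDimensional 𝕜 E] [FiniteDimensional 𝕜 F]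
    (hp : IsOrbitFactorization ρ z₀ p i) (hρ : ContMDiff 𝓘(𝕜, E) 𝓘(𝕜, V) ∞ fun g => ρ g z₀)
    (hF : Module.finrank 𝕜 F = Module.finrank 𝕜 (modelDeriv 𝕜 E V (fun g => ρ g z₀) 1).range) :
    ∃ (_ : TopologicalSpace X) (_ : ChartedSpace F X), IsOpenQuotientMap p ∧
      ∀ e ∈ atlas F X, IsProjectionChart 𝕜 E p i e := by
  have : ContinuousMul G := continuousMul_of_contMDiffMul 𝓘(𝕜, E) ∞
  let _ := TopologicalSpace.coinduced p inferInstance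
  have hquot : IsOpenQuotientMap p := isOpenQuotientMap_coinduced hp.surjective hp.mul_eq_mul
  obtain ⟨hcharts, hatlas⟩ := exists_chartedSpace_isProjectionChart (F := F) hquot hp.injective
    (hp.contMDiff_comp hρ) fun g => (hp.finrank_range_modelDeriv hρ g).trans hF.symm
  exact ⟨_, hcharts, hquot, hatlas⟩

variable [TopologicalSpace X] [ChartedSpace F X]

theorem isOrbitManifold [FiniteDimensional 𝕜 F] [SecondCountableTopology G]
    (hp : IsOrbitFactorization ρ z₀ p i) (hρ : ContMDiff 𝓘(𝕜, E) 𝓘(𝕜, V) ∞ fun g => ρ g z₀)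
    (hF : Module.finrank 𝕜 F = Module.finrank 𝕜 (modelDeriv 𝕜 E V (fun g => ρ g z₀) 1).range)
    (hquot : IsOpenQuotientMap p) (hX : ∀ e ∈ atlas F X, IsProjectionChart 𝕜 E p i e) :
    IsOrbitManifold 𝕜 E F p := by
  have hf := hp.contMDiff_comp hρ
  have hmanifold := isManifold_of_isProjectionChart hX hf
  have hi := contMDiff_of_isProjectionChart hX hf
  have hpsmooth := contMDiff_of_comp_of_isProjectionChart hX hquot.continuous hf
  refine ⟨hmanifold, .of_injective_continuous hp.injective hi.continuous,
    hquot.isQuotientMap.secondCountableTopology hquot.isOpenMap, hp.surjective, hpsmooth,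
    fun g => ?_⟩
  have hcomp := modelDeriv_comp g (hi.mdifferentiableAt (by simp))
    (hpsmooth.mdifferentiableAt (by simp))
  have hrank := (hp.finrank_range_modelDeriv hρ g).trans hF.symm
  rw [hcomp] at hrank
  have hsurjective : Function.Surjective (modelDeriv 𝕜 E F p g) :=
    surjective_of_finrank_range_comp_eq hrank
  exact hsurjective

end IsOrbitFactorization
end OrbitFactorization

section InfinitesimalAction

variable {𝕜 : Type*} [NontriviallyNormedField 𝕜]
  {E : Type*} [NormedAddCommGroup E] [NormedSpace 𝕜 E]
  {F : Type*} [NormedAddCommGroup F] [NormedSpace 𝕜 F]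
  {G : Type*} [TopologicalSpace G] [ChartedSpace E G] [Group G]
  {X : Type*} [TopologicalSpace X] [ChartedSpace F X] {p : G → X}

variable (𝕜 E F) in
/-- The infinitesimal action `v ↦ d/dt exp(tv) • x` of the Lie algebra at the point `x = p g` of a
homogeneous space with orbit map `p`; the translate `h • x` is `p (h * g)`. -/
noncomputable def infinitesimalAction (p : G → X) (g : G) : E →L[𝕜] F :=
  modelDeriv 𝕜 E F (fun h => p (h * g)) 1

theorem surjective_modelDeriv_mul_right [LieGroup 𝓘(𝕜, E) ∞ G] (h g : G) :
    Function.Surjective (modelDeriv 𝕜 E E (fun x : G => x * g) h) := by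
  have hright : ∀ g : G, ContMDiff 𝓘(𝕜, E) 𝓘(𝕜, E) ∞ fun x : G => x * g :=
    fun g => contMDiff_mul_right
  have hcomp := modelDeriv_comp (g := fun x : G => x * g) (f := fun x : G => x * g⁻¹) (h * g)
    ((hright g).mdifferentiableAt (by simp)) ((hright g⁻¹).mdifferentiableAt (by simp))
  simp only [inv_mul_cancel_right, mul_inv_cancel_right, modelDeriv_id] at hcomp
  exact Function.RightInverse.surjective fun v => (DFunLike.congr_fun hcomp v).symm

theorem IsOrbitManifold.surjective_infinitesimalAction [LieGroup 𝓘(𝕜, E) ∞ G]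
    (hp : IsOrbitManifold 𝕜 E F p) (g : G) :
    Function.Surjective (infinitesimalAction 𝕜 E F p g) := by
  have hright : ContMDiff 𝓘(𝕜, E) 𝓘(𝕜, E) ∞ fun h : G => h * g := contMDiff_mul_right
  have hsurjective : Function.Surjective (modelDeriv 𝕜 E F p (1 * g)) :=
    hp.surjective_mfderiv (1 * g)
  rw [infinitesimalAction, modelDeriv_comp 1 (hp.contMDiff.mdifferentiableAt (by simp))
    (hright.mdifferentiableAt (by simp))]
  exact hsurjective.comp (surjective_modelDeriv_mul_right 1 g)

end InfinitesimalAction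

section Stabilizer

variable {𝕜 : Type*} [RCLike 𝕜]
  {E : Type*} [NormedAddCommGroup E] [NormedSpace 𝕜 E] [FiniteDimensional 𝕜 E]
  {V : Type*} [NormedAddCommGroup V] [NormedSpace 𝕜 V] [FiniteDimensional 𝕜 V]
  {F : Type*} [NormedAddCommGroup F] [NormedSpace 𝕜 F]
  {G : Type*} [TopologicalSpace G] [ChartedSpace E G] [Group G] [LieGroup 𝓘(𝕜, E) ∞ G]
  {X : Type*} [TopologicalSpace X] [ChartedSpace F X]
  {ρ : G →* (V →L[𝕜] V)} {z₀ : V} {p : G → X} {i : X → V}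

theorem IsOrbitFactorization.stabilizerLieAlgebra_eq_ker (hp : IsOrbitFactorization ρ z₀ p i)
    (hρ : ∀ z, ContMDiff 𝓘(𝕜, E) 𝓘(𝕜, V) ∞ fun g => ρ g z) (hX : IsOrbitManifold 𝕜 E F p)
    (hi : IsSubmanifold 𝕜 F V i) (g : G) :
    stabilizerLieAlgebra 𝕜 E ρ (i (p g)) = (infinitesimalAction 𝕜 E F p g).ker := by
  have hright : ContMDiff 𝓘(𝕜, E) 𝓘(𝕜, E) ∞ fun h : G => h * g := contMDiff_mul_right
  have htranslate : ContMDiff 𝓘(𝕜, E) 𝓘(𝕜, F) ∞ fun h => p (h * g) := hX.contMDiff.comp hright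
  have hcomp := modelDeriv_comp 1 (hi.contMDiff.mdifferentiableAt (by simp))
    (htranslate.mdifferentiableAt (by simp))
  have hinjective : Function.Injective (modelDeriv 𝕜 F V i (p (1 * g))) :=
    hi.injective_mfderiv (p (1 * g))
  simp only [hp.apply_mul] at hcomp
  rw [CoadjointCR.stabilizerLieAlgebra_eq_ker (hρ _), hcomp]
  ext v
  exact map_eq_zero_iff _ hinjective

end Stabilizer

section RestrictScalars

variable {E : Type*} [NormedAddCommGroup E] [NormedSpace ℂ E]
  {E' : Type*} [NormedAddCommGroup E'] [NormedSpace ℂ E']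
  {N : Type*} [TopologicalSpace N] [ChartedSpace E N]
  {N' : Type*} [TopologicalSpace N'] [ChartedSpace E' N'] {f : N → N'}

theorem contMDiff_restrictScalars (hf : ContMDiff 𝓘(ℂ, E) 𝓘(ℂ, E') ∞ f) :
    ContMDiff 𝓘(ℝ, E) 𝓘(ℝ, E') ∞ f := fun x =>
  have ⟨hcont, hdiff⟩ := contMDiffAt_iff.1 (hf x)
  contMDiffAt_iff.2 ⟨hcont, hdiff.restrict_scalars ℝ⟩

theorem modelDeriv_restrictScalars {x : N} (hf : MDifferentiableAt 𝓘(ℂ, E) 𝓘(ℂ, E') f x) :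
    modelDeriv ℝ E E' f x = (modelDeriv ℂ E E' f x).restrictScalars ℝ := by
  have hreal : HasMFDerivAt 𝓘(ℝ, E) 𝓘(ℝ, E') f x ((modelDeriv ℂ E E' f x).restrictScalars ℝ) :=
    ⟨hf.hasMFDerivAt.1, HasFDerivWithinAt.restrictScalars ℝ hf.hasMFDerivAt.2⟩
  exact hreal.mfderiv

end RestrictScalars

section Complexification

variable {W : Type*} [AddCommGroup W] [Module ℝ W]

theorem tmul_add_I_tmul_inj {u v u' v' : W}
    (h : (1 : ℂ) ⊗ₜ[ℝ] u + Complex.I ⊗ₜ[ℝ] v = (1 : ℂ) ⊗ₜ[ℝ] u' + Complex.I ⊗ₜ[ℝ] v') :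
    u = u' ∧ v = v' := by
  have hre := congrArg (fun x => TensorProduct.lid ℝ W (Complex.reLm.rTensor W x)) h
  have him := congrArg (fun x => TensorProduct.lid ℝ W (Complex.imLm.rTensor W x)) h
  exact ⟨by simpa using hre, by simpa using him⟩

theorem smul_tmul_add_I_tmul (c : ℂ) (u v : W) :
    c • ((1 : ℂ) ⊗ₜ[ℝ] u + Complex.I ⊗ₜ[ℝ] v) =
      (1 : ℂ) ⊗ₜ[ℝ] (c.re • u - c.im • v) + Complex.I ⊗ₜ[ℝ] (c.im • u + c.re • v) := by
  have hc : c = c.re • (1 : ℂ) + c.im • Complex.I := by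
    apply Complex.ext <;> simp
  have hcI : c * Complex.I = c.re • Complex.I - c.im • (1 : ℂ) := by
    apply Complex.ext <;> simp
  calc c • ((1 : ℂ) ⊗ₜ[ℝ] u + Complex.I ⊗ₜ[ℝ] v)
      = c ⊗ₜ[ℝ] u + (c * Complex.I) ⊗ₜ[ℝ] v := by
        simp only [smul_add, TensorProduct.smul_tmul', smul_eq_mul, mul_one]
    _ = (c.re • (1 : ℂ) + c.im • Complex.I) ⊗ₜ[ℝ] u +
          (c.re • Complex.I - c.im • (1 : ℂ)) ⊗ₜ[ℝ] v := by rw [← hc, hcI]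
    _ = _ := by
        simp only [TensorProduct.add_tmul, TensorProduct.sub_tmul, TensorProduct.tmul_add,
          TensorProduct.tmul_sub, TensorProduct.smul_tmul]
        abel

theorem mem_baseChange_complex_iff (S : Submodule ℝ W) (x : ℂ ⊗[ℝ] W) :
    x ∈ S.baseChange ℂ ↔ ∃ u ∈ S, ∃ v ∈ S, x = (1 : ℂ) ⊗ₜ[ℝ] u + Complex.I ⊗ₜ[ℝ] v := by
  constructor
  · intro hx
    rw [Submodule.baseChange_eq_span] at hx
    induction hx using Submodule.span_induction with
    | mem x hx =>
      obtain ⟨u, hu, rfl⟩ := hx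
      exact ⟨u, hu, 0, S.zero_mem, by simp⟩
    | zero => exact ⟨0, S.zero_mem, 0, S.zero_mem, by simp⟩
    | add x y _ _ hx hy =>
      obtain ⟨u, hu, v, hv, rfl⟩ := hx
      obtain ⟨u', hu', v', hv', rfl⟩ := hy
      refine ⟨u + u', S.add_mem hu hu', v + v', S.add_mem hv hv', ?_⟩
      simp only [TensorProduct.tmul_add]
      abel
    | smul c x _ hx =>
      obtain ⟨u, hu, v, hv, rfl⟩ := hx
      exact ⟨_, S.sub_mem (S.smul_mem _ hu) (S.smul_mem _ hv), _,
        S.add_mem (S.smul_mem _ hu) (S.smul_mem _ hv), smul_tmul_add_I_tmul c u v⟩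
  · rintro ⟨u, hu, v, hv, rfl⟩
    exact add_mem (Submodule.tmul_mem_baseChange_of_mem _ hu)
      (Submodule.tmul_mem_baseChange_of_mem _ hv)

theorem exists_eq_tmul_add_I_tmul (x : ℂ ⊗[ℝ] W) :
    ∃ u v : W, x = (1 : ℂ) ⊗ₜ[ℝ] u + Complex.I ⊗ₜ[ℝ] v := by
  obtain ⟨u, -, v, -, h⟩ := (mem_baseChange_complex_iff (⊤ : Submodule ℝ W) x).1
    (by rw [Submodule.baseChange_top]; trivial)
  exact ⟨u, v, h⟩

theorem finrank_baseChange_complex [FiniteDimensional ℝ W] (S : Submodule ℝ W) :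
    Module.finrank ℂ (S.baseChange ℂ) = Module.finrank ℝ S := by
  rw [← (Submodule.toBaseChange.toLinearEquiv ℂ S).finrank_eq, Module.finrank_baseChange]

end Complexification

section OneZeroPart

variable {F : Type*} [AddCommGroup F] [Module ℂ F]

variable (F) in
/-- Multiplication by `i` on a complex vector space, as a real-linear map. -/
noncomputable def mulI : F →ₗ[ℝ] F := (LinearMap.lsmul ℂ F Complex.I).restrictScalars ℝ

theorem mulI_apply (u : F) : mulI F u = Complex.I • u := rfl

theorem mulI_mulI (u : F) : mulI F (mulI F u) = -u := by
  rw [mulI_apply, mulI_apply, smul_smul, Complex.I_mul_I, neg_one_smul]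

theorem mulI_injective : Function.Injective (mulI F) := fun u v h => by
  have h' := congrArg (mulI F) h
  rwa [mulI_mulI, mulI_mulI, neg_inj] at h'

/-- The space `S^{1,0} = (S ⊗ ℂ) ∩ F^{1,0}` attached to a real subspace `S` of a complex vector
space `F`, where `F^{1,0}` is the `i`-eigenspace of `mulI F ⊗ ℂ`; `tangentOneZero` is the case where
`S` is a tangent space. -/
noncomputable def oneZeroPart (S : Submodule ℝ F) : Submodule ℂ (ℂ ⊗[ℝ] F) :=
  S.baseChange ℂ ⊓ Module.End.eigenspace ((mulI F).baseChange ℂ) Complex.I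

/-- The real-linear isomorphism `u ↦ u - i J u` of `F` onto `F^{1,0}`, where `J = mulI F`. -/
noncomputable def holomorphicPart : F →ₗ[ℝ] ℂ ⊗[ℝ] F :=
  TensorProduct.mk ℝ ℂ F 1 + TensorProduct.mk ℝ ℂ F Complex.I ∘ₗ (-mulI F)

theorem holomorphicPart_apply (u : F) :
    holomorphicPart u = (1 : ℂ) ⊗ₜ[ℝ] u + Complex.I ⊗ₜ[ℝ] (-mulI F u) := rfl

theorem holomorphicPart_injective : Function.Injective (holomorphicPart (F := F)) :=
  fun _ _ h => (tmul_add_I_tmul_inj h).1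

theorem tmul_add_I_tmul_mem_eigenspace_iff (u v : F) :
    (1 : ℂ) ⊗ₜ[ℝ] u + Complex.I ⊗ₜ[ℝ] v ∈
      Module.End.eigenspace ((mulI F).baseChange ℂ) Complex.I ↔ v = -mulI F u := by
  rw [Module.End.mem_eigenspace_iff, smul_tmul_add_I_tmul]
  simp only [map_add, LinearMap.baseChange_tmul, Complex.I_re, Complex.I_im, zero_smul, one_smul,
    zero_sub, add_zero]
  constructor
  · intro h
    rw [(tmul_add_I_tmul_inj h).1, neg_neg]
  · rintro rfl
    rw [neg_neg, map_neg, mulI_mulI, neg_neg]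

theorem restrictScalars_oneZeroPart (S : Submodule ℝ F) :
    (oneZeroPart S).restrictScalars ℝ = (S ⊓ S.map (mulI F)).map holomorphicPart := by
  ext x
  rw [Submodule.restrictScalars_mem, oneZeroPart, Submodule.mem_inf, mem_baseChange_complex_iff]
  constructor
  · rintro ⟨⟨u, hu, v, hv, rfl⟩, h⟩
    rw [tmul_add_I_tmul_mem_eigenspace_iff] at h
    subst h
    exact ⟨u, ⟨hu, _, hv, by rw [map_neg, mulI_mulI, neg_neg]⟩, rfl⟩
  · rintro ⟨u, ⟨hu, s, hs, rfl⟩, rfl⟩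
    rw [holomorphicPart_apply]
    refine ⟨⟨_, hu, _, ?_, rfl⟩, (tmul_add_I_tmul_mem_eigenspace_iff _ _).2 rfl⟩
    rwa [mulI_mulI, neg_neg]

variable [FiniteDimensional ℂ F]

theorem finiteDimensional_oneZeroPart (S : Submodule ℝ F) :
    FiniteDimensional ℂ (oneZeroPart S) := by
  have : FiniteDimensional ℝ F := FiniteDimensional.complexToReal F
  have : Module.Finite ℂ (ℂ ⊗[ℝ] F) := Module.Finite.base_change ℝ ℂ F
  infer_instance

theorem finrank_oneZeroPart_add {S : Submodule ℝ F} (hS : S ⊔ S.map (mulI F) = ⊤) :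
    Module.finrank ℂ (oneZeroPart S) + Module.finrank ℂ F = Module.finrank ℝ S := by
  have : FiniteDimensional ℝ F := FiniteDimensional.complexToReal F
  have hreal : Module.finrank ℝ (oneZeroPart S) = Module.finrank ℝ ↥(S ⊓ S.map (mulI F)) := by
    have e := (Submodule.equivMapOfInjective _ holomorphicPart_injective
      (S ⊓ S.map (mulI F))).finrank_eq
    rw [← restrictScalars_oneZeroPart] at e
    exact e.symm
  have hinf := Submodule.finrank_sup_add_finrank_inf_eq S (S.map (mulI F))
  rw [hS, finrank_top, finrank_real_of_complex F, ← hreal,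
    ← Module.finrank_mul_finrank ℝ ℂ (oneZeroPart S), Complex.finrank_real_complex,
    ← (Submodule.equivMapOfInjective _ mulI_injective S).finrank_eq] at hinf
  omega

end OneZeroPart

section RealFormLinearAlgebra

variable {F : Type*} [AddCommGroup F] [Module ℂ F]
  {E₀ : Type*} [AddCommGroup E₀] [Module ℝ E₀] {E : Type*} [AddCommGroup E] [Module ℂ E]

/-- The complexification `S^ℂ` of a real subspace `S` of `E₀`, as a subspace of `E`, when
`D : E₀ → E` exhibits `E` as the complexification of `E₀`. -/
noncomputable def complexification (D : E₀ →ₗ[ℝ] E) (S : Submodule ℝ E₀) : Submodule ℂ E :=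
  (S.baseChange ℂ).map (LinearMap.liftBaseChange ℂ D)

theorem range_sup_map_mulI_eq_top {B : E →ₗ[ℂ] F} (hB : Function.Surjective B) {D : E₀ →ₗ[ℝ] E}
    (hD : Function.Surjective (LinearMap.liftBaseChange ℂ D)) :
    (B.restrictScalars ℝ ∘ₗ D).range ⊔ (B.restrictScalars ℝ ∘ₗ D).range.map (mulI F) = ⊤ := by
  refine eq_top_iff.2 fun y _ => ?_
  obtain ⟨x, rfl⟩ := hB y
  obtain ⟨t, rfl⟩ := hD x
  obtain ⟨u, v, rfl⟩ := exists_eq_tmul_add_I_tmul t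
  rw [map_add, map_add]
  exact Submodule.add_mem_sup ⟨u, by simp⟩ ⟨_, ⟨v, rfl⟩, by simp [mulI_apply]⟩

theorem complexification_ker_le (B : E →ₗ[ℂ] F) (D : E₀ →ₗ[ℝ] E) :
    complexification D (B.restrictScalars ℝ ∘ₗ D).ker ≤ B.ker := by
  rintro _ ⟨x, hx, rfl⟩
  obtain ⟨u, hu, v, hv, rfl⟩ := (mem_baseChange_complex_iff _ _).1 hx
  have hBu : B (D u) = 0 := hu
  have hBv : B (D v) = 0 := hv
  simp [hBu, hBv]

theorem finrank_complexification [FiniteDimensional ℝ E₀] {D : E₀ →ₗ[ℝ] E}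
    (hD : Function.Injective (LinearMap.liftBaseChange ℂ D)) (S : Submodule ℝ E₀) :
    Module.finrank ℂ (complexification D S) = Module.finrank ℝ S := by
  rw [complexification, ← (Submodule.equivMapOfInjective _ hD _).finrank_eq,
    finrank_baseChange_complex]

variable [FiniteDimensional ℝ E₀] [FiniteDimensional ℂ E]

theorem finrank_ker_quotient_complexification_add {B : E →ₗ[ℂ] F} (hB : Function.Surjective B)
    {D : E₀ →ₗ[ℝ] E} (hD : Function.Bijective (LinearMap.liftBaseChange ℂ D)) :
    Module.finrank ℂ (B.ker ⧸
        (complexification D (B.restrictScalars ℝ ∘ₗ D).ker).submoduleOf B.ker) +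
      Module.finrank ℂ F = Module.finrank ℝ (B.restrictScalars ℝ ∘ₗ D).range := by
  have hquotient := Submodule.finrank_quotient_add_finrank
    ((complexification D (B.restrictScalars ℝ ∘ₗ D).ker).submoduleOf B.ker)
  rw [(Submodule.submoduleOfEquivOfLe (complexification_ker_le B D)).finrank_eq,
    finrank_complexification hD.1] at hquotient
  have hrankB := LinearMap.finrank_range_add_finrank_ker B
  rw [LinearMap.range_eq_top.2 hB, finrank_top] at hrankB
  have hrankBD := LinearMap.finrank_range_add_finrank_ker (B.restrictScalars ℝ ∘ₗ D)
  have hE := (LinearEquiv.ofBijective _ hD).finrank_eq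
  rw [Module.finrank_baseChange] at hE
  omega

theorem nonempty_oneZeroPart_equiv [FiniteDimensional ℂ F] {B : E →ₗ[ℂ] F}
    (hB : Function.Surjective B) {D : E₀ →ₗ[ℝ] E}
    (hD : Function.Bijective (LinearMap.liftBaseChange ℂ D)) :
    Nonempty (oneZeroPart (B.restrictScalars ℝ ∘ₗ D).range ≃ₗ[ℂ] (B.ker ⧸
      (complexification D (B.restrictScalars ℝ ∘ₗ D).ker).submoduleOf B.ker)) := by
  have := finiteDimensional_oneZeroPart (B.restrictScalars ℝ ∘ₗ D).range
  exact ⟨LinearEquiv.ofFinrankEq _ _ (Nat.add_right_cancel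
    ((finrank_oneZeroPart_add (range_sup_map_mulI_eq_top hB hD.2)).trans
      (finrank_ker_quotient_complexification_add hB hD).symm))⟩

end RealFormLinearAlgebra

section TangentBundle

variable {𝕜 : Type*} [NontriviallyNormedField 𝕜]
  {E : Type*} [NormedAddCommGroup E] [NormedSpace 𝕜 E]
  {N : Type*} [TopologicalSpace N] [ChartedSpace E N]

theorem tangentBundleCore_coordChange_of_eq [IsManifold 𝓘(𝕜, E) 1 N] {a b c : N} (hab : a = b)
    (hc : c ∈ (chartAt E a).source) (v : E) :
    (tangentBundleCore 𝓘(𝕜, E) N).coordChange (achart E a) (achart E b) c v = v := by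
  subst hab
  exact (tangentBundleCore 𝓘(𝕜, E) N).coordChange_self _ _ hc v

end TangentBundle

section Coadjoint

variable {𝕜 : Type*} [NontriviallyNormedField 𝕜]
  {E : Type*} [NormedAddCommGroup E] [NormedSpace 𝕜 E]
  {G : Type*} [TopologicalSpace G] [ChartedSpace E G] [Group G]

theorem Ad_eq_modelDeriv (g : G) : Ad 𝕜 E g = modelDeriv 𝕜 E E (fun x : G => g * x * g⁻¹) 1 := rfl

theorem Ad_one : Ad 𝕜 E (1 : G) = 1 := by
  simp only [Ad_eq_modelDeriv, one_mul, inv_one, mul_one]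
  exact modelDeriv_id 1

variable [LieGroup 𝓘(𝕜, E) ∞ G]

theorem contMDiff_conj (g : G) : ContMDiff 𝓘(𝕜, E) 𝓘(𝕜, E) ∞ fun x : G => g * x * g⁻¹ :=
  (contMDiff_const.mul contMDiff_id).mul contMDiff_const

theorem Ad_mul (g h : G) : Ad 𝕜 E (g * h) = Ad 𝕜 E g * Ad 𝕜 E h := by
  have hcomp := modelDeriv_comp (g := fun x : G => g * x * g⁻¹) (f := fun x : G => h * x * h⁻¹) 1
    ((contMDiff_conj (𝕜 := 𝕜) (E := E) g).mdifferentiableAt (by simp))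
    ((contMDiff_conj (𝕜 := 𝕜) (E := E) h).mdifferentiableAt (by simp))
  rw [mul_one, mul_inv_cancel] at hcomp
  refine Eq.trans ?_ hcomp
  simp only [Ad_eq_modelDeriv, mul_inv_rev, mul_assoc]

theorem contMDiff_Ad : ContMDiff 𝓘(𝕜, E) 𝓘(𝕜, E →L[𝕜] E) ∞ (Ad 𝕜 E : G → E →L[𝕜] E) := by
  have : IsManifold 𝓘(𝕜, E) ∞ G := inferInstance
  have : IsManifold 𝓘(𝕜, E) 1 G := .of_le (n := ∞) (by simp)
  intro g₀
  have hconj : ContMDiff (𝓘(𝕜, E).prod 𝓘(𝕜, E)) 𝓘(𝕜, E) ∞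
      (Function.uncurry fun g x : G => g * x * g⁻¹) :=
    (contMDiff_fst.mul contMDiff_snd).mul contMDiff_fst.inv
  have hsmooth := ContMDiffAt.mfderiv (m := ∞) (n := ∞) (fun g x : G => g * x * g⁻¹)
    (fun _ : G => 1) (hconj.contMDiffAt (x := (g₀, 1))) contMDiffAt_const (by simp)
  have hone : ∀ g : G, g * 1 * g⁻¹ = 1 := fun g => by group
  refine hsmooth.congr_of_eventuallyEq (.of_forall fun g => ?_)
  ext v
  have hcoord := inTangentCoordinates_eq (I := 𝓘(𝕜, E)) (I' := 𝓘(𝕜, E)) (fun _ : G => (1 : G))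
    (fun x : G => x * 1 * x⁻¹) (fun g : G => Ad 𝕜 E g) (x₀ := g₀) (x := g) (mem_chart_source E 1)
    (by rw [hone, hone]; exact mem_chart_source E 1)
  refine Eq.trans ?_ (DFunLike.congr_fun hcoord v).symm
  have heq := (hone g).trans (hone g₀).symm
  rw [ContinuousLinearMap.comp_apply, ContinuousLinearMap.comp_apply,
    tangentBundleCore_coordChange_of_eq rfl (mem_chart_source E 1),
    tangentBundleCore_coordChange_of_eq heq (mem_chart_source E _)]

variable (𝕜 E G) in
/-- The coadjoint representation `coAd` as a homomorphism into the continuous endomorphisms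
of `𝔤*`. -/
noncomputable def coadjointRep : G →* (StrongDual 𝕜 E →L[𝕜] StrongDual 𝕜 E) where
  toFun g := (ContinuousLinearMap.compL 𝕜 E E 𝕜).flip (Ad 𝕜 E g⁻¹)
  map_one' := by
    ext z v
    simp [Ad_one]
  map_mul' g h := by
    ext z v
    simp [Ad_mul]

theorem contMDiff_coadjointRep (z : StrongDual 𝕜 E) :
    ContMDiff 𝓘(𝕜, E) 𝓘(𝕜, StrongDual 𝕜 E) ∞ fun g => coadjointRep 𝕜 E G g z :=
  ((ContinuousLinearMap.compL 𝕜 E E 𝕜) z).contMDiff.comp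
    (contMDiff_Ad.comp (contMDiff_inv 𝓘(𝕜, E) ∞))

end Coadjoint

section RealFormOrbit

variable {E₀ : Type*} [NormedAddCommGroup E₀] [NormedSpace ℝ E₀]
  {E : Type*} [NormedAddCommGroup E] [NormedSpace ℂ E]
  {F₀ : Type*} [NormedAddCommGroup F₀] [NormedSpace ℝ F₀]
  {F : Type*} [NormedAddCommGroup F] [NormedSpace ℂ F]
  {G₀ : Type*} [TopologicalSpace G₀] [ChartedSpace E₀ G₀] [Group G₀] [LieGroup 𝓘(ℝ, E₀) ∞ G₀]
  {G : Type*} [TopologicalSpace G] [ChartedSpace E G] [Group G] [LieGroup 𝓘(ℂ, E) ∞ G]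
  {X₀ : Type*} [TopologicalSpace X₀] [ChartedSpace F₀ X₀]
  {X : Type*} [TopologicalSpace X] [ChartedSpace F X]
  {j : G₀ →* G} {p₀ : G₀ → X₀} {p : G → X} {ι : X₀ → X}

theorem modelDeriv_comp_infinitesimalAction (hj : ContMDiff 𝓘(ℝ, E₀) 𝓘(ℝ, E) ∞ j)
    (hp₀ : ContMDiff 𝓘(ℝ, E₀) 𝓘(ℝ, F₀) ∞ p₀) (hp : ContMDiff 𝓘(ℂ, E) 𝓘(ℂ, F) ∞ p)
    (hι : ContMDiff 𝓘(ℝ, F₀) 𝓘(ℝ, F) ∞ ι) (hιp : ∀ g, ι (p₀ g) = p (j g)) (g : G₀) :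
    modelDeriv ℝ F₀ F ι (p₀ g) ∘L infinitesimalAction ℝ E₀ F₀ p₀ g =
      (infinitesimalAction ℂ E F p (j g)).restrictScalars ℝ ∘L differential E₀ E j := by
  have hp₀g : ContMDiff 𝓘(ℝ, E₀) 𝓘(ℝ, F₀) ∞ fun h => p₀ (h * g) := hp₀.comp contMDiff_mul_right
  have hpg : ContMDiff 𝓘(ℂ, E) 𝓘(ℂ, F) ∞ fun h => p (h * j g) := hp.comp contMDiff_mul_right
  have hpgℝ := contMDiff_restrictScalars hpg
  have hleft := modelDeriv_comp 1 (hι.mdifferentiableAt (by simp))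
    (hp₀g.mdifferentiableAt (by simp))
  have hright := modelDeriv_comp 1 (hpgℝ.mdifferentiableAt (by simp))
    (hj.mdifferentiableAt (by simp))
  rw [map_one, modelDeriv_restrictScalars (hpg.mdifferentiableAt (by simp))] at hright
  simp only [hιp, map_mul, one_mul] at hleft
  exact hleft.symm.trans hright

theorem tangent_eq_range_infinitesimalAction (hj : ContMDiff 𝓘(ℝ, E₀) 𝓘(ℝ, E) ∞ j)
    (hp₀ : IsOrbitManifold ℝ E₀ F₀ p₀) (hp : ContMDiff 𝓘(ℂ, E) 𝓘(ℂ, F) ∞ p)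
    (hι : ContMDiff 𝓘(ℝ, F₀) 𝓘(ℝ, F) ∞ ι) (hιp : ∀ g, ι (p₀ g) = p (j g)) (g : G₀) :
    tangent F₀ F ι (p₀ g) = ((infinitesimalAction ℂ E F p (j g)).toLinearMap.restrictScalars ℝ ∘ₗ
      (differential E₀ E j).toLinearMap).range := by
  have hcomp := congrArg (fun T : E₀ →L[ℝ] F => T.toLinearMap.range)
    (modelDeriv_comp_infinitesimalAction hj hp₀.contMDiff hp hι hιp g)
  exact (LinearMap.range_comp_of_range_eq_top _ (LinearMap.range_eq_top.2
    (hp₀.surjective_infinitesimalAction g))).symm.trans hcomp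

theorem ker_infinitesimalAction_eq (hj : ContMDiff 𝓘(ℝ, E₀) 𝓘(ℝ, E) ∞ j)
    (hp₀ : ContMDiff 𝓘(ℝ, E₀) 𝓘(ℝ, F₀) ∞ p₀) (hp : ContMDiff 𝓘(ℂ, E) 𝓘(ℂ, F) ∞ p)
    (hι : IsSubmanifold ℝ F₀ F ι) (hιp : ∀ g, ι (p₀ g) = p (j g)) (g : G₀) :
    (infinitesimalAction ℝ E₀ F₀ p₀ g).ker =
      ((infinitesimalAction ℂ E F p (j g)).toLinearMap.restrictScalars ℝ ∘ₗ
        (differential E₀ E j).toLinearMap).ker := by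
  have hcomp := congrArg (fun T : E₀ →L[ℝ] F => T.toLinearMap.ker)
    (modelDeriv_comp_infinitesimalAction hj hp₀ hp hι.contMDiff hιp g)
  exact (LinearMap.ker_comp_of_ker_eq_bot _ (LinearMap.ker_eq_bot.2
    (hι.injective_mfderiv (p₀ g)))).symm.trans hcomp

theorem tangent_sup_map_mulI_eq_top (hj : IsRealForm E₀ E j)
    (hp₀ : IsOrbitManifold ℝ E₀ F₀ p₀) (hp : IsOrbitManifold ℂ E F p)
    (hι : ContMDiff 𝓘(ℝ, F₀) 𝓘(ℝ, F) ∞ ι) (hιp : ∀ g, ι (p₀ g) = p (j g)) (x : X₀) :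
    (tangent F₀ F ι x : Submodule ℝ F) ⊔ (tangent F₀ F ι x : Submodule ℝ F).map (mulI F) = ⊤ := by
  obtain ⟨g, rfl⟩ := hp₀.surjective x
  have htangent := tangent_eq_range_infinitesimalAction hj.contMDiff hp₀ hp.contMDiff hι hιp g
  exact (congrArg (fun S : Submodule ℝ F => S ⊔ S.map (mulI F)) htangent).trans
    (range_sup_map_mulI_eq_top (hp.surjective_infinitesimalAction (j g)) hj.bijective.2)

variable [FiniteDimensional ℂ F]

theorem isGenericCRSubmanifold_of_isRealForm (hj : IsRealForm E₀ E j)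
    (hp₀ : IsOrbitManifold ℝ E₀ F₀ p₀) (hp : IsOrbitManifold ℂ E F p)
    (hι : IsSubmanifold ℝ F₀ F ι) (hιp : ∀ g, ι (p₀ g) = p (j g)) :
    IsGenericCRSubmanifold F₀ F ι := by
  have hgeneric := tangent_sup_map_mulI_eq_top hj hp₀ hp hι.contMDiff hιp
  refine ⟨⟨hι, Module.finrank ℝ F₀ - Module.finrank ℂ F, fun x => Nat.eq_sub_of_add_eq ?_⟩,
    hgeneric⟩
  have hdim : Module.finrank ℝ (tangent F₀ F ι x) = Module.finrank ℝ F₀ :=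
    LinearMap.finrank_range_of_inj (hι.injective_mfderiv x)
  exact (finrank_oneZeroPart_add (F := F) (hgeneric x)).trans hdim

theorem nonempty_tangentOneZero_equiv [FiniteDimensional ℝ E₀] [FiniteDimensional ℂ E]
    (hj : IsRealForm E₀ E j) (hp₀ : IsOrbitManifold ℝ E₀ F₀ p₀) (hp : IsOrbitManifold ℂ E F p)
    (hι : IsSubmanifold ℝ F₀ F ι) (hιp : ∀ g, ι (p₀ g) = p (j g)) (g : G₀) :
    Nonempty (tangentOneZero F₀ F ι (p₀ g) ≃ₗ[ℂ] ((infinitesimalAction ℂ E F p (j g)).ker ⧸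
      (complexification (differential E₀ E j).toLinearMap
        (infinitesimalAction ℝ E₀ F₀ p₀ g).ker).submoduleOf
          (infinitesimalAction ℂ E F p (j g)).ker)) := by
  have htangent := congrArg (oneZeroPart (F := F))
    (tangent_eq_range_infinitesimalAction hj.contMDiff hp₀ hp.contMDiff hι.contMDiff hιp g)
  obtain ⟨e⟩ := nonempty_oneZeroPart_equiv (hp.surjective_infinitesimalAction (j g)) hj.bijective
  rw [ker_infinitesimalAction_eq hj.contMDiff hp₀.contMDiff hp.contMDiff hι hιp]
  exact ⟨(LinearEquiv.ofEq _ _ htangent).trans e⟩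

end RealFormOrbit

section RealRepresentation

variable {V : Type*} [NormedAddCommGroup V] [NormedSpace ℂ V]
  {G₀ : Type*} [Group G₀] {G : Type*} [Group G]

/-- The restriction of a complex representation of `G` along `j : G₀ → G`, as a real
representation of `G₀`. -/
noncomputable def realRep (ρ : G →* (V →L[ℂ] V)) (j : G₀ →* G) : G₀ →* (V →L[ℝ] V) where
  toFun g := (ρ (j g)).restrictScalars ℝ
  map_one' := by ext; simp
  map_mul' g h := by ext; simp

variable {E₀ : Type*} [NormedAddCommGroup E₀] [NormedSpace ℝ E₀]
  {E : Type*} [NormedAddCommGroup E] [NormedSpace ℂ E]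
  [TopologicalSpace G₀] [ChartedSpace E₀ G₀] [TopologicalSpace G] [ChartedSpace E G]

theorem contMDiff_realRep {ρ : G →* (V →L[ℂ] V)} {z : V}
    (hρ : ContMDiff 𝓘(ℂ, E) 𝓘(ℂ, V) ∞ fun g => ρ g z) {j : G₀ →* G}
    (hj : ContMDiff 𝓘(ℝ, E₀) 𝓘(ℝ, E) ∞ j) :
    ContMDiff 𝓘(ℝ, E₀) 𝓘(ℝ, V) ∞ fun g => realRep ρ j g z :=
  (contMDiff_restrictScalars hρ).comp hj

end RealRepresentation

section Submanifold

variable {𝕜 : Type*} [NontriviallyNormedField 𝕜]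
  {E : Type*} [NormedAddCommGroup E] [NormedSpace 𝕜 E]
  {F : Type*} [NormedAddCommGroup F] [NormedSpace 𝕜 F]
  {V : Type*} [NormedAddCommGroup V] [NormedSpace 𝕜 V]
  {L : Type*} [TopologicalSpace L] [ChartedSpace E L]
  {M : Type*} [TopologicalSpace M] [ChartedSpace F M]
  {N : Type*} [TopologicalSpace N] [ChartedSpace V N]

theorem IsSubmanifold.of_comp {i : M → N} {ι : L → M}
    (h : IsSubmanifold 𝕜 E V fun x => i (ι x)) (hi : ContMDiff 𝓘(𝕜, F) 𝓘(𝕜, V) ∞ i)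
    (hι : ContMDiff 𝓘(𝕜, E) 𝓘(𝕜, F) ∞ ι) : IsSubmanifold 𝕜 E F ι := by
  refine ⟨hι, h.injective.of_comp, fun x => ?_⟩
  have hinjective : Function.Injective (modelDeriv 𝕜 E V (fun x => i (ι x)) x) :=
    h.injective_mfderiv x
  rw [modelDeriv_comp x (hi.mdifferentiableAt (by simp)) (hι.mdifferentiableAt (by simp))]
    at hinjective
  exact Function.Injective.of_comp (f := modelDeriv 𝕜 F V i (ι x)) hinjective

end Submanifold

section Orbits

variable {V : Type*} [NormedAddCommGroup V] [NormedSpace ℂ V]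
  {G₀ : Type*} [Group G₀] {G : Type*} [Group G] {X₀ : Type*} {X : Type*}
  {ρ : G →* (V →L[ℂ] V)} {j : G₀ →* G} {z₀ : V} {p : G → X} {i : X → V} {p₀ : G₀ → X₀} {ι : X₀ → X}

theorem IsOrbitFactorization.apply_realRep (hp : IsOrbitFactorization ρ z₀ p i)
    (hp₀ : IsOrbitFactorization (realRep ρ j) z₀ p₀ fun x => i (ι x)) (g : G₀) :
    ι (p₀ g) = p (j g) :=
  hp.injective ((hp₀.apply g).trans (hp.apply (j g)).symm)

variable {E₀ : Type*} [NormedAddCommGroup E₀] [NormedSpace ℝ E₀]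
  {E : Type*} [NormedAddCommGroup E] [NormedSpace ℂ E]
  {F₀ : Type*} [NormedAddCommGroup F₀] [NormedSpace ℝ F₀]
  {F : Type*} [NormedAddCommGroup F] [NormedSpace ℂ F]
  [TopologicalSpace G₀] [ChartedSpace E₀ G₀] [TopologicalSpace G] [ChartedSpace E G]
  [TopologicalSpace X₀] [ChartedSpace F₀ X₀] [TopologicalSpace X] [ChartedSpace F X]

theorem isSubmanifold_realOrbit [IsManifold 𝓘(ℝ, F₀) ∞ X₀] [IsManifold 𝓘(ℂ, F) ∞ X]
    (hρ : ContMDiff 𝓘(ℂ, E) 𝓘(ℂ, V) ∞ fun g => ρ g z₀) (hj : ContMDiff 𝓘(ℝ, E₀) 𝓘(ℝ, E) ∞ j)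
    (hp : IsOrbitFactorization ρ z₀ p i)
    (hp₀ : IsOrbitFactorization (realRep ρ j) z₀ p₀ fun x => i (ι x))
    (hquot : IsOpenQuotientMap p) (hX : ∀ e ∈ atlas F X, IsProjectionChart ℂ E p i e)
    (hquot₀ : IsOpenQuotientMap p₀)
    (hX₀ : ∀ e ∈ atlas F₀ X₀, IsProjectionChart ℝ E₀ p₀ (fun x => i (ι x)) e) :
    IsSubmanifold ℝ F₀ F ι := by
  have hcomp := isSubmanifold_of_isProjectionChart hp₀.injective hX₀
    (hp₀.contMDiff_comp (contMDiff_realRep hρ hj))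
  have hi := contMDiff_restrictScalars (contMDiff_of_isProjectionChart hX (hp.contMDiff_comp hρ))
  have hcont : Continuous ι := by
    have hιp : ι ∘ p₀ = p ∘ j := funext fun g => hp.apply_realRep hp₀ g
    rw [hquot₀.isQuotientMap.continuous_iff, hιp]
    exact hquot.continuous.comp hj.continuous
  exact hcomp.of_comp hi (contMDiff_of_comp_of_isProjectionChart hX hcont hcomp.contMDiff)

section Stabilizers

variable [FiniteDimensional ℝ E₀] [FiniteDimensional ℂ E] [FiniteDimensional ℂ V]
  [LieGroup 𝓘(ℝ, E₀) ∞ G₀] [LieGroup 𝓘(ℂ, E) ∞ G]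

theorem complexification_stabilizerLieAlgebra_le (hj : ContMDiff 𝓘(ℝ, E₀) 𝓘(ℝ, E) ∞ j) {z : V}
    (hρ : ContMDiff 𝓘(ℂ, E) 𝓘(ℂ, V) ∞ fun g => ρ g z) :
    complexification (differential E₀ E j).toLinearMap
      (stabilizerLieAlgebra ℝ E₀ (realRep ρ j) z) ≤ stabilizerLieAlgebra ℂ E ρ z := by
  have : FiniteDimensional ℝ V := FiniteDimensional.complexToReal V
  have hcomp := modelDeriv_comp 1 ((contMDiff_restrictScalars hρ).mdifferentiableAt (by simp))
    (hj.mdifferentiableAt (by simp))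
  rw [map_one, modelDeriv_restrictScalars (hρ.mdifferentiableAt (by simp))] at hcomp
  have hker := congrArg (fun T : E₀ →L[ℝ] V => T.toLinearMap.ker) hcomp
  rw [stabilizerLieAlgebra_eq_ker (contMDiff_realRep hρ hj), stabilizerLieAlgebra_eq_ker hρ]
  exact (congrArg _ hker).trans_le (complexification_ker_le _ _)

theorem nonempty_tangentOneZero_equiv_stabilizer [FiniteDimensional ℂ F] (hj : IsRealForm E₀ E j)
    (hρ : ∀ z, ContMDiff 𝓘(ℂ, E) 𝓘(ℂ, V) ∞ fun g => ρ g z)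
    (hp : IsOrbitFactorization ρ z₀ p i)
    (hp₀ : IsOrbitFactorization (realRep ρ j) z₀ p₀ fun x => i (ι x))
    (hM : IsOrbitManifold ℂ E F p) (hO : IsOrbitManifold ℝ E₀ F₀ p₀)
    (hi : IsSubmanifold ℂ F V i) (hi₀ : IsSubmanifold ℝ F₀ V fun x => i (ι x))
    (hι : IsSubmanifold ℝ F₀ F ι) (x : X₀) :
    Nonempty (tangentOneZero F₀ F ι x ≃ₗ[ℂ] (stabilizerLieAlgebra ℂ E ρ (i (ι x)) ⧸
      (complexification (differential E₀ E j).toLinearMap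
        (stabilizerLieAlgebra ℝ E₀ (realRep ρ j) (i (ι x)))).submoduleOf
          (stabilizerLieAlgebra ℂ E ρ (i (ι x))))) := by
  have : FiniteDimensional ℝ V := FiniteDimensional.complexToReal V
  have hιp : ∀ g, ι (p₀ g) = p (j g) := fun g => hp.apply_realRep hp₀ g
  obtain ⟨g, rfl⟩ := hp₀.surjective x
  have hker₀ := hp₀.stabilizerLieAlgebra_eq_ker (fun z => contMDiff_realRep (hρ z) hj.contMDiff)
    hO hi₀ g
  have hker := hp.stabilizerLieAlgebra_eq_ker hρ hM hi (j g)
  rw [← hιp] at hker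
  rw [hker₀, hker, hιp]
  exact nonempty_tangentOneZero_equiv hj hO hM hι hιp g

end Stabilizers
end Orbits

end CoadjointCR

open CoadjointCR in
theorem mainTheorem9_general
    {E₀ : Type*} [NormedAddCommGroup E₀] [NormedSpace ℝ E₀] [FiniteDimensional ℝ E₀]
    {E : Type*} [NormedAddCommGroup E] [NormedSpace ℂ E] [FiniteDimensional ℂ E]
    {V : Type*} [NormedAddCommGroup V] [NormedSpace ℂ V] [FiniteDimensional ℂ V]
    {G₀ : Type*} [TopologicalSpace G₀] [ChartedSpace E₀ G₀] [Group G₀]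
    [LieGroup 𝓘(ℝ, E₀) ∞ G₀] [SecondCountableTopology G₀]
    {G : Type*} [TopologicalSpace G] [ChartedSpace E G] [Group G]
    [LieGroup 𝓘(ℂ, E) ∞ G] [SecondCountableTopology G]
    {ρ : G →* (V →L[ℂ] V)} (hρ : ∀ z, ContMDiff 𝓘(ℂ, E) 𝓘(ℂ, V) ∞ fun g => ρ g z)
    {j : G₀ →* G} (hj : IsRealForm E₀ E j) {z₀ : V}
    {X₀ X : Type*} {p : G → X} {i : X → V} {p₀ : G₀ → X₀} {ι : X₀ → X}
    (hp : IsOrbitFactorization ρ z₀ p i)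
    (hp₀ : IsOrbitFactorization (realRep ρ j) z₀ p₀ fun x => i (ι x)) :
    ∃ (F : Type) (_ : NormedAddCommGroup F) (_ : NormedSpace ℂ F) (_ : FiniteDimensional ℂ F)
      (_ : TopologicalSpace X) (_ : ChartedSpace F X)
      (F₀ : Type) (_ : NormedAddCommGroup F₀) (_ : NormedSpace ℝ F₀)
      (_ : FiniteDimensional ℝ F₀)
      (_ : TopologicalSpace X₀) (_ : ChartedSpace F₀ X₀),
      IsOrbitManifold ℂ E F p ∧ IsSubmanifold ℂ F V i ∧
      IsOrbitManifold ℝ E₀ F₀ p₀ ∧ IsGenericCRSubmanifold F₀ F ι ∧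
      ∀ x : X₀,
        complexification (differential E₀ E j).toLinearMap
          (stabilizerLieAlgebra ℝ E₀ (realRep ρ j) (i (ι x))) ≤
          stabilizerLieAlgebra ℂ E ρ (i (ι x)) ∧
        Nonempty (tangentOneZero F₀ F ι x ≃ₗ[ℂ]
          (stabilizerLieAlgebra ℂ E ρ (i (ι x)) ⧸
            (complexification (differential E₀ E j).toLinearMap
              (stabilizerLieAlgebra ℝ E₀ (realRep ρ j)
                (i (ι x)))).submoduleOf
              (stabilizerLieAlgebra ℂ E ρ (i (ι x))))) := by
  have : FiniteDimensional ℝ V := FiniteDimensional.complexToReal V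
  have hρ₀ := fun z => contMDiff_realRep (hρ z) hj.contMDiff
  obtain ⟨_, _, hquot, hX⟩ := hp.exists_chartedSpace (hρ z₀) (Module.finrank_fin_fun ℂ)
  obtain ⟨_, _, hquot₀, hX₀⟩ := hp₀.exists_chartedSpace (hρ₀ z₀) (Module.finrank_fin_fun ℝ)
  have hM := hp.isOrbitManifold (hρ z₀) (Module.finrank_fin_fun ℂ) hquot hX
  have hO := hp₀.isOrbitManifold (hρ₀ z₀) (Module.finrank_fin_fun ℝ) hquot₀ hX₀
  have := hM.isManifold
  have := hO.isManifold
  have hi := isSubmanifold_of_isProjectionChart hp.injective hX (hp.contMDiff_comp (hρ z₀))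
  have hi₀ := isSubmanifold_of_isProjectionChart hp₀.injective hX₀ (hp₀.contMDiff_comp (hρ₀ z₀))
  have hι := isSubmanifold_realOrbit (hρ z₀) hj.contMDiff hp hp₀ hquot hX hquot₀ hX₀
  have hιp : ∀ g, ι (p₀ g) = p (j g) := fun g => hp.apply_realRep hp₀ g
  exact ⟨_, _, _, inferInstance, _, _, _, _, _, inferInstance, _, _, hM, hi, hO,
    isGenericCRSubmanifold_of_isRealForm hj hO hM hι hιp, fun x =>
    ⟨complexification_stabilizerLieAlgebra_le hj.contMDiff (hρ _),
      nonempty_tangentOneZero_equiv_stabilizer hj hρ hp hp₀ hM hO hi hi₀ hι x⟩⟩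

theorem mainTheorem9
    {E₀ : Type*} [NormedAddCommGroup E₀] [NormedSpace ℝ E₀] [FiniteDimensional ℝ E₀]
    {E : Type*} [NormedAddCommGroup E] [NormedSpace ℂ E] [FiniteDimensional ℂ E]
    {G₀ : Type*} [TopologicalSpace G₀] [ChartedSpace E₀ G₀] [Group G₀]
    [LieGroup 𝓘(ℝ, E₀) ∞ G₀] [SecondCountableTopology G₀]
    {G : Type*} [TopologicalSpace G] [ChartedSpace E G] [Group G]
    [LieGroup 𝓘(ℂ, E) ∞ G] [SecondCountableTopology G]
    (j : G₀ →* G) (hj : CoadjointCR.IsRealForm E₀ E j)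
    (z₀ : StrongDual ℂ E) :
    ∃ (F : Type) (_ : NormedAddCommGroup F) (_ : NormedSpace ℂ F) (_ : FiniteDimensional ℂ F)
      (_ : TopologicalSpace (CoadjointCR.Orbit G z₀))
      (_ : ChartedSpace F (CoadjointCR.Orbit G z₀))
      (F₀ : Type) (_ : NormedAddCommGroup F₀) (_ : NormedSpace ℝ F₀)
      (_ : FiniteDimensional ℝ F₀)
      (_ : TopologicalSpace (CoadjointCR.RealOrbit j z₀))
      (_ : ChartedSpace F₀ (CoadjointCR.RealOrbit j z₀)),
      -- the `G`-orbit is a complex submanifold of `𝔤*`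
      CoadjointCR.IsOrbitManifold ℂ E F (CoadjointCR.orbitMap (G := G) z₀) ∧
      CoadjointCR.IsSubmanifold ℂ F (StrongDual ℂ E)
        (CoadjointCR.orbitInclusion (G := G) z₀) ∧
      -- the `G₀`-orbit is a generic CR-submanifold of it
      CoadjointCR.IsOrbitManifold ℝ E₀ F₀ (CoadjointCR.realOrbitMap j z₀) ∧
      CoadjointCR.IsGenericCRSubmanifold F₀ F (CoadjointCR.realOrbitInclusion j z₀) ∧
      -- `T^{1,0}_z ≅ 𝔤^z / (𝔤₀^z)^ℂ`
      ∀ z : CoadjointCR.RealOrbit j z₀,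
        CoadjointCR.complexifiedRealStabilizerAlgebra E₀ j z.1 ≤
          CoadjointCR.stabilizerAlgebra G z.1 ∧
        Nonempty (CoadjointCR.tangentOneZero F₀ F (CoadjointCR.realOrbitInclusion j z₀) z ≃ₗ[ℂ]
          (CoadjointCR.stabilizerAlgebra G z.1 ⧸
            (CoadjointCR.complexifiedRealStabilizerAlgebra E₀ j z.1).submoduleOf
              (CoadjointCR.stabilizerAlgebra G z.1))) := by
  exact mainTheorem9_general (ρ := CoadjointCR.coadjointRep ℂ E G)
    CoadjointCR.contMDiff_coadjointRep hj
    ⟨fun z => z.2.imp fun _ h => Subtype.ext h, Subtype.val_injective, fun _ => rfl⟩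
    ⟨fun z => z.2.imp fun _ h => Subtype.ext h, Subtype.val_injective, fun _ => rfl⟩
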